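/- Let $p\ge 1$, $c\in[0,1]$, $\omega=(\omega_1,\dots,\omega_p)$ with all $\omega_k\ge 0$ and at least one $\omega_k>0$, and $\mu=(\mu_1,\dots,\mu_p)\in\mathbb R^p$. Under $\mathbf P_\mu$ let $X_{k,\ell}$ ($1\le k\le p$, $\ell\ge 1$) be independent with $X_{k,\ell}\sim N(\mu_k,1)$, and let $f_a$ denote the density of $N(a,1)$. Put $\hat\mu_{k,1}=0$ and, for $\ell\ge 2$, $$\hat\mu_{k,\ell}=\omega_k+c\Big(\frac{X_{k,1}+\dots+X_{k,\ell-1}}{\ell-1}-\omega_k\Big),$$ and define $$\Lambda_n=\prod_{\ell=1}^n\prod_{k=1}^p\frac{f_{\hat\mu_{k,\ell}}(X_{k,\ell})}{f_0(X_{k,\ell})},\qquad \tau_b=\inf\{n\ge 1:\Lambda_n\ge e^b\}$$ (with $\inf\emptyset=\infty$). Let $\mu^*_k=\omega_k+c(\mu_k-\omega_k)$ and $$I=I(\mu^*,0;\mu)=\mathbf E_\mu\sum_{k=1}^p\log\frac{f_{\mu^*_k}(X_{k,1})}{f_0(X_{k,1})}=\tfrac12\big[\|\mu\|^2-(1-c)^2\|\mu-\omega\|^2\big].$$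 If $I>0$, then $\mathbf E_\mu(\tau_b)<\infty$ for every real $b$ and, for fixed $p,c,\omega,\mu$, as $b\to\infty$, $$\mathbf E_\mu(\tau_b)=\frac{b+(pc^2/2)\log b-(pc^2/2)\log I}{I}+o(p\log b).$$ -/

import Mathlib

open MeasureTheory ProbabilityTheory Filter Asymptotics
open scoped ENNReal BigOperators

noncomputable section

/-- The linear shrinkage estimate at time `ℓ` of the mean of one stream `x 1, x 2, …`, with
shrinkage factor `c` and target `w`: it is `0` at time `ℓ = 1`, and for `ℓ ≥ 2` it is
`w + c * (mean of x 1, …, x (ℓ - 1) - w)`. The entry `x 0` is never used. -/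
def shrinkEst (c w : ℝ) (x : ℕ → ℝ) (ℓ : ℕ) : ℝ :=
  if ℓ ≤ 1 then 0
  else w + c * ((∑ i ∈ Finset.Icc 1 (ℓ - 1), x i) / ((ℓ : ℝ) - 1) - w)

/-- The plug-in likelihood ratio `Λ_n` of `N(estimate, 1)` against `N(0, 1)`, computed from the
observations `x k ℓ` of stream `k` at times `ℓ = 1, …, n`. -/
def plugInLR {p : ℕ} (c : ℝ) (w : Fin p → ℝ) (x : Fin p → ℕ → ℝ) (n : ℕ) : ℝ :=
  ∏ ℓ ∈ Finset.Icc 1 n, ∏ k : Fin p,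
    gaussianPDFReal (shrinkEst c (w k) (x k) ℓ) 1 (x k ℓ) / gaussianPDFReal 0 1 (x k ℓ)

/-- The stopping time `τ_b = inf {n ≥ 1 : Λ_n ≥ exp b}`, equal to `⊤` if there is no such `n`. -/
def stopTime {p : ℕ} (c : ℝ) (w : Fin p → ℝ) (b : ℝ) (x : Fin p → ℕ → ℝ) : ℕ∞ :=
  ⨅ (n : ℕ) (_ : 1 ≤ n ∧ Real.exp b ≤ plugInLR c w x n), (n : ℕ∞)

/-- The vector `μ*` with entries `ω_k + c (μ_k - ω_k)`. -/
def shrunkMean {p : ℕ} (c : ℝ) (w μ : Fin p → ℝ) : Fin p → ℝ :=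
  fun k => w k + c * (μ k - w k)

/-- The information number `I(ψ, φ; μ) = E_μ ∑_k log (f_{ψ_k}(X_k) / f_{φ_k}(X_k))`, where the
`X_k` are independent with law `N(μ_k, 1)` and `f_a` is the density of `N(a, 1)`. -/
def infoNumber {p : ℕ} (ψ φ μ : Fin p → ℝ) : ℝ :=
  ∫ x : Fin p → ℝ,
    ∑ k, Real.log (gaussianPDFReal (ψ k) 1 (x k) / gaussianPDFReal (φ k) 1 (x k))
    ∂(Measure.pi fun k => gaussianReal (μ k) 1)

theorem log_gaussianPDFReal_div (a b y : ℝ) :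
    Real.log (gaussianPDFReal a 1 y / gaussianPDFReal b 1 y)
      = (a - b) * y - (a ^ 2 - b ^ 2) / 2 := by
  have h : gaussianPDFReal a 1 y / gaussianPDFReal b 1 y
      = Real.exp ((a - b) * y - (a ^ 2 - b ^ 2) / 2) := by
    rw [div_eq_iff (gaussianPDFReal_pos b 1 y one_ne_zero).ne']
    simp only [gaussianPDFReal]
    rw [mul_left_comm, ← Real.exp_add]
    congr 2
    push_cast
    ring
  rw [h, Real.log_exp]

/-- The closed form of the information number at `(μ*, 0)`. -/
theorem infoNumber_shrunkMean_zero {p : ℕ} (c : ℝ) (w μ : Fin p → ℝ) :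
    infoNumber (shrunkMean c w μ) 0 μ
      = (1 / 2) * (∑ k, μ k ^ 2 - (1 - c) ^ 2 * ∑ k, (μ k - w k) ^ 2) := by
  have hint : ∀ k : Fin p, Integrable (fun x : Fin p → ℝ => x k)
      (Measure.pi fun k => gaussianReal (μ k) 1) := fun k =>
    integrable_comp_eval (μ := fun k => gaussianReal (μ k) 1) (i := k) (f := fun y : ℝ => y)
      ((memLp_id_gaussianReal 1).integrable le_rfl)
  have hval : ∀ k : Fin p, ∫ x : Fin p → ℝ, x k ∂(Measure.pi fun k => gaussianReal (μ k) 1)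
      = μ k := fun k => by
    rw [integral_comp_eval (μ := fun k => gaussianReal (μ k) 1) (i := k) (f := fun y : ℝ => y)
      aestronglyMeasurable_id]
    exact integral_id_gaussianReal
  unfold infoNumber
  simp only [log_gaussianPDFReal_div]
  have hsub : ∀ (k : Fin p) (a d : ℝ), Integrable (fun x : Fin p → ℝ => a * x k - d)
      (Measure.pi fun k => gaussianReal (μ k) 1) := fun k a d =>
    ((hint k).const_mul a).sub (integrable_const d)
  rw [integral_finsetSum _ fun k _ => hsub k _ _, Finset.mul_sum, ← Finset.sum_sub_distrib, Finset.mul_sum]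
  refine Finset.sum_congr rfl fun k _ => ?_
  rw [integral_sub ((hint k).const_mul _) (integrable_const _), integral_const_mul, hval]
  simp only [shrunkMean, Pi.zero_apply, integral_const, probReal_univ, one_smul]
  ring

end

/-! Write `ξ` for the centred observations and `ξ̄_i` for the average of the first `i` of them in a
stream. Expanding the Gaussian ratio, `log Λ_n = ∑_{i<n} Z_i` with `Z_i = I·1{i≠0} + D_i - R_i`.
Here `D_i = ∑_k (plug-in estimate)·ξ` is a martingale difference, and `R_i = ∑_k (a_k ξ̄_i + (c²/2)
ξ̄_i²)` is the price of estimation. Since `E R_i = (pc²/2)/i`, the price paid up to the typical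
passage time `N = ⌈b/I⌉` is `(pc²/2) log(b/I) + O(1)`, which is the second-order term.

To justify this, stop at `T = min(τ_b, 2N)`. Optional stopping gives `E S_T = I·E T - I - E ∑_{i<T}
R_i`, and three errors must be `o(log b)`. (1) `E S_T - b`: above, it is at most the expected
largest increment before time `2N`, hence at most `η log N + K` for every `η > 0`
(`exists_envelope`); below, it is bounded by a constant (`le_integral_stopped_incr`). (2) `E ∑_{i<T}
R_i - ∑_{i<N} E R_i`: `T` depends on the `R_i`, which have size `i^{-1/2}`, so this is not a matter
of independence. A weighted AM-GM inequality combined with `E (T-N)² = O(N)` gives `η log N + O(1)`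
(`abs_integral_stopped_rem_sub_le`). (3) `E τ_b - E T ≤ ∑_i P(S_i ≤ I i/2)`, a convergent series
(`summable_real_sum_llrIncr_le`).

`IsPerturbedWalk` lists what this argument needs, `expected_passage` carries it out, and
`exists_isPerturbedWalk` verifies the list for the likelihood ratio. -/

set_option linter.unusedSectionVars false

/-! ### Harmonic sums and deterministic inequalities for stopped sums -/

/-- The real harmonic number `1 + 1/2 + ⋯ + 1/m`. -/
noncomputable def harm (m : ℕ) : ℝ := ∑ i ∈ Finset.range m, 1 / ((i : ℝ) + 1)

theorem harm_eq_harmonic (m : ℕ) : harm m = (harmonic m : ℝ) := by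
  simp [harm, harmonic]

theorem harm_nonneg (m : ℕ) : 0 ≤ harm m := Finset.sum_nonneg fun i _ => by positivity

theorem harm_mono : Monotone harm := fun _ _ h =>
  Finset.sum_le_sum_of_subset_of_nonneg (Finset.range_mono h) fun i _ _ => by positivity

theorem harm_le_one_add_log (m : ℕ) : harm m ≤ 1 + Real.log m := by
  rw [harm_eq_harmonic]; exact harmonic_le_one_add_log m

theorem log_le_harm (m : ℕ) : Real.log m ≤ harm m := by
  rw [harm_eq_harmonic]
  rcases Nat.eq_zero_or_pos m with rfl | hm
  · simp
  refine le_trans (Real.log_le_log (by exact_mod_cast hm) ?_) (log_add_one_le_harmonic m)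
  push_cast; linarith

theorem sum_inv_sqrt_le (m : ℕ) :
    ∑ i ∈ Finset.range m, 1 / √((i : ℝ) + 1) ≤ 2 * √(m : ℝ) := by
  induction m with
  | zero => simp
  | succ m ih =>
    rw [Finset.sum_range_succ]
    have h1 : 0 < √((m : ℝ) + 1) := Real.sqrt_pos.2 (by positivity)
    have h2 : √((m : ℝ) + 1) ^ 2 = m + 1 := Real.sq_sqrt (by positivity)
    have h3 : √(m : ℝ) ^ 2 = m := Real.sq_sqrt (by positivity)
    have h4 : 1 / √((m : ℝ) + 1) ≤ 2 * √((m : ℝ) + 1) - 2 * √(m : ℝ) := by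
      rw [div_le_iff₀ h1]
      nlinarith [sq_nonneg (√((m : ℝ) + 1) - √(m : ℝ))]
    push_cast
    linarith

/-- Cauchy–Schwarz with weights `(i+1)^{-1/2}`. When `r i ^ 2` has mean of order `1/(i+1)`, the
right side has mean of order `m`; constant weights would lose a factor `log m`. -/
theorem sum_abs_sq_le_sqrt_weighted (r : ℕ → ℝ) (m : ℕ) :
    (∑ i ∈ Finset.range m, |r i|) ^ 2
      ≤ 2 * √(m : ℝ) * ∑ i ∈ Finset.range m, √((i : ℝ) + 1) * r i ^ 2 := by
  have h := Finset.sum_mul_sq_le_sq_mul_sq (Finset.range m)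
    (fun i => √(1 / √((i : ℝ) + 1))) (fun i => √(√((i : ℝ) + 1)) * |r i|)
  have e1 : ∀ i : ℕ, √(1 / √((i : ℝ) + 1)) * (√(√((i : ℝ) + 1)) * |r i|) = |r i| := fun i => by
    have : 0 < √(√((i : ℝ) + 1)) := by positivity
    rw [Real.sqrt_div zero_le_one, Real.sqrt_one]
    field_simp
  have e2 : ∀ i : ℕ, √(1 / √((i : ℝ) + 1)) ^ 2 = 1 / √((i : ℝ) + 1) := fun i =>
    Real.sq_sqrt (by positivity)
  have e3 : ∀ i : ℕ, (√(√((i : ℝ) + 1)) * |r i|) ^ 2 = √((i : ℝ) + 1) * r i ^ 2 := fun i => by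
    rw [mul_pow, Real.sq_sqrt (by positivity), sq_abs]
  simp only [e1, e2, e3] at h
  refine h.trans (mul_le_mul_of_nonneg_right (sum_inv_sqrt_le m) ?_)
  exact Finset.sum_nonneg fun i _ => by positivity

theorem harm_sq_le (n : ℕ) : (1 + harm n) ^ 2 ≤ 36 * √((n : ℝ) + 1) := by
  have hx : (0 : ℝ) < n + 1 := by positivity
  -- With `y = (n+1)^{1/4} ≥ 1`, the bound `log x ≤ 4 x^{1/4}` gives `1 + harm n ≤ 2 + 4y ≤ 6y`,
  -- whence the constant 36.
  have h1 : harm n ≤ 1 + 4 * ((n : ℝ) + 1) ^ (1 / 4 : ℝ) := by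
    refine (harm_mono n.le_succ).trans ((harm_le_one_add_log _).trans ?_)
    have := Real.log_le_rpow_div hx.le (show (0 : ℝ) < 1 / 4 by norm_num)
    push_cast
    linarith
  have h2 : (1 : ℝ) ≤ ((n : ℝ) + 1) ^ (1 / 4 : ℝ) :=
    Real.one_le_rpow (by linarith [(Nat.cast_nonneg n : (0 : ℝ) ≤ n)]) (by norm_num)
  have h3 : (((n : ℝ) + 1) ^ (1 / 4 : ℝ)) ^ 2 = √((n : ℝ) + 1) := by
    rw [← Real.rpow_natCast, ← Real.rpow_mul hx.le, Real.sqrt_eq_rpow]; norm_num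
  rw [← h3]
  have := harm_nonneg n
  nlinarith

theorem summable_harm_sq_div : Summable fun n : ℕ => (1 + harm n) ^ 2 / ((n : ℝ) + 1) ^ 2 := by
  have h : Summable fun n : ℕ => 36 * (1 / ((n : ℝ) + 1) ^ (3 / 2 : ℝ)) := by
    refine Summable.mul_left _ ?_
    have := (summable_nat_add_iff 1).2 (Real.summable_one_div_nat_rpow (p := 3 / 2).2 (by norm_num))
    simpa using this
  refine Summable.of_nonneg_of_le (fun n => by positivity) (fun n => ?_) h
  have hx : (0 : ℝ) < n + 1 := by positivity
  rw [div_le_iff₀ (by positivity)]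
  refine (harm_sq_le n).trans (le_of_eq ?_)
  have : √((n : ℝ) + 1) * ((n : ℝ) + 1) ^ (3 / 2 : ℝ) = ((n : ℝ) + 1) ^ 2 := by
    rw [Real.sqrt_eq_rpow, ← Real.rpow_add hx]; norm_num
  rw [← this]
  field_simp

/-- `T` is the smaller of `m` and the first index at which `S` reaches `b`; `S 0 < b` excludes index
`0`. If the level is not reached by time `m`, then `T = m`, which is why only `min b (S m)` bounds
`S T` from below. -/
theorem exists_stop_index (S : ℕ → ℝ) (b : ℝ) (h0 : S 0 < b) (m : ℕ) (hm : 1 ≤ m) :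
    ∃ T, 1 ≤ T ∧ T ≤ m ∧ (∀ i < m, ((∀ n ≤ i, S n < b) ↔ i < T)) ∧
      min b (S m) ≤ S T ∧ S (T - 1) < b := by
  classical
  by_cases h : ∀ n < m, S n < b
  · refine ⟨m, hm, le_rfl, fun i hi => ⟨fun _ => hi, fun _ n hn => h n (by omega)⟩,
      min_le_right _ _, h _ (by omega)⟩
  · push Not at h
    have hex : ∃ n, b ≤ S n := let ⟨n, _, hn⟩ := h; ⟨n, hn⟩
    obtain ⟨n, hnm, hn⟩ := h
    have hlt : ∀ k < Nat.find hex, S k < b := fun k hk => not_le.1 (Nat.find_min hex hk)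
    have hpos : 1 ≤ Nat.find hex := by
      rw [Nat.one_le_iff_ne_zero]
      intro h'
      have := Nat.find_spec hex
      rw [h'] at this
      linarith
    have hle : Nat.find hex ≤ n := Nat.find_min' hex hn
    refine ⟨Nat.find hex, hpos, by omega, fun i hi => ⟨fun H => ?_, fun H k hk => hlt k (by omega)⟩,
      (min_le_left _ _).trans (Nat.find_spec hex), hlt _ (by omega)⟩
    by_contra hcon
    exact absurd (Nat.find_spec hex) (not_le.2 (H _ (not_lt.1 hcon)))

theorem sum_range_ite_lt {M : Type*} [AddCommMonoid M] (f : ℕ → M) {T m : ℕ} (h : T ≤ m) :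
    ∑ i ∈ Finset.range m, (if i < T then f i else 0) = ∑ i ∈ Finset.range T, f i := by
  rw [← Finset.sum_filter]
  congr 1
  ext i
  simp only [Finset.mem_filter, Finset.mem_range]
  omega

theorem sum_abs_ite_sub_ite {T N m : ℕ} (hT : T ≤ m) (hN : N ≤ m) :
    ∑ i ∈ Finset.range m, |(if i < T then (1 : ℝ) else 0) - (if i < N then 1 else 0)|
      = |(T : ℝ) - N| := by
  wlog h : T ≤ N generalizing T N
  · rw [abs_sub_comm, ← this hN hT (by omega)]
    exact Finset.sum_congr rfl fun i _ => abs_sub_comm _ _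
  have h1 := sum_range_ite_lt (fun _ => (1 : ℝ)) hT
  have h2 := sum_range_ite_lt (fun _ => (1 : ℝ)) hN
  simp only [Finset.sum_const, Finset.card_range, nsmul_eq_mul, mul_one] at h1 h2
  rw [abs_sub_comm, abs_of_nonneg (sub_nonneg.2 (by exact_mod_cast h)), ← h1, ← h2,
    ← Finset.sum_sub_distrib]
  refine Finset.sum_congr rfl fun i _ => ?_
  by_cases hi : i < T
  · simp [hi, hi.trans_le h]
  · by_cases hi' : i < N <;> simp [hi, hi']

/-- Only the `|T - N|` indices between `T` and `N` count, and each weight is at most `(|T - N| + 1)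
/ N`. The integer inequality `d ≤ d²` absorbs the `+ 1`. -/
theorem sum_between_weight_le {T N m : ℕ} (hT : T ≤ m) (hN : N ≤ m) :
    ∑ i ∈ Finset.range m, |(if i < T then (1 : ℝ) else 0) - (if i < N then 1 else 0)|
        * ((|(i : ℝ) - N| + 1) / N) ≤ 2 * ((T : ℝ) - N) ^ 2 / N := by
  have key : ∀ i ∈ Finset.range m,
      |(if i < T then (1 : ℝ) else 0) - (if i < N then 1 else 0)| * ((|(i : ℝ) - N| + 1) / N)
      ≤ |(if i < T then (1 : ℝ) else 0) - (if i < N then 1 else 0)|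
        * ((|(T : ℝ) - N| + 1) / N) := by
    intro i _
    by_cases h1 : i < T <;> by_cases h2 : i < N <;> simp only [h1, h2, if_true, if_false, sub_self,
      abs_zero, zero_mul, le_refl]
    · have h1' : (i : ℝ) < T := by exact_mod_cast h1
      have h2' : (N : ℝ) ≤ i := by exact_mod_cast not_lt.1 h2
      have h3 : |(i : ℝ) - N| ≤ |(T : ℝ) - N| := by
        rw [abs_of_nonneg (by linarith), abs_of_nonneg (by linarith)]
        linarith
      exact mul_le_mul_of_nonneg_left (by gcongr) (abs_nonneg _)
    · have h1' : (T : ℝ) ≤ i := by exact_mod_cast not_lt.1 h1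
      have h2' : (i : ℝ) < N := by exact_mod_cast h2
      have h3 : |(i : ℝ) - N| ≤ |(T : ℝ) - N| := by
        rw [abs_of_nonpos (by linarith), abs_of_nonpos (by linarith)]
        linarith
      exact mul_le_mul_of_nonneg_left (by gcongr) (abs_nonneg _)
  refine (Finset.sum_le_sum key).trans ?_
  rw [← Finset.sum_mul, sum_abs_ite_sub_ite hT hN, ← mul_div_assoc]
  refine div_le_div_of_nonneg_right ?_ (Nat.cast_nonneg N)
  have h : |(T : ℝ) - N| ≤ ((T : ℝ) - N) ^ 2 := by
    have hz : |((T : ℤ) - N : ℤ)| ≤ ((T : ℤ) - N) ^ 2 := by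
      rw [← Int.natCast_natAbs, ← Int.natAbs_sq]
      exact_mod_cast Nat.le_self_pow two_ne_zero _
    exact_mod_cast hz
  nlinarith [sq_abs ((T : ℝ) - N)]

/-- With `x = |i - N| + 1` and `y = i + 1` one has `N ≤ x + y`, so `N/(xy) ≤ 1/x + 1/y`, and both
parts sum to harmonic numbers. -/
theorem sum_weight_div_le {N : ℕ} :
    ∑ i ∈ Finset.range (N + N), (N : ℝ) / (|(i : ℝ) - N| + 1) * (1 / ((i : ℝ) + 1))
      ≤ 3 * harm (N + N) := by
  have h1 : ∀ i : ℕ, (N : ℝ) / (|(i : ℝ) - N| + 1) * (1 / ((i : ℝ) + 1))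
      ≤ 1 / (|(i : ℝ) - N| + 1) + 1 / ((i : ℝ) + 1) := fun i => by
    have hx : 0 < |(i : ℝ) - N| + 1 := by positivity
    have hy : (0 : ℝ) < i + 1 := by positivity
    rw [div_mul_div_comm, div_add_div _ _ hx.ne' hy.ne']
    gcongr
    have := neg_abs_le ((i : ℝ) - N)
    linarith
  refine (Finset.sum_le_sum fun i _ => h1 i).trans ?_
  rw [Finset.sum_add_distrib]
  have h2 : ∑ i ∈ Finset.range (N + N), 1 / (|(i : ℝ) - N| + 1) ≤ harm N + harm N := by
    rw [Finset.sum_range_add]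
    refine add_le_add ?_ (le_of_eq ?_)
    · rw [harm, ← Finset.sum_range_reflect]
      refine Finset.sum_le_sum fun i hi => ?_
      rw [Finset.mem_range] at hi
      refine one_div_le_one_div_of_le (by positivity) ?_
      rw [Nat.sub_sub, Nat.cast_sub (by omega)]
      push_cast
      have := neg_abs_le ((i : ℝ) - N)
      linarith [neg_abs_le ((N : ℝ) - (1 + i) - N)]
    · refine Finset.sum_congr rfl fun i _ => ?_
      push_cast
      rw [add_sub_cancel_left, abs_of_nonneg (by positivity)]
  have h3 : harm N ≤ harm (N + N) := harm_mono (by omega)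
  have h4 : ∑ i ∈ Finset.range (N + N), 1 / ((i : ℝ) + 1) = harm (N + N) := rfl
  linarith

theorem pos_part_sub_le_sq_div {y d : ℝ} (hd : 0 < d) : max (y - d) 0 ≤ y ^ 2 / (4 * d) := by
  refine max_le ?_ (by positivity)
  rw [le_div_iff₀ (by positivity)]
  nlinarith [sq_nonneg (y - 2 * d)]

/-! ### Variables with all moments, so that polynomial expressions are integrable -/

/-- The real function `f` has finite absolute moments of all orders. -/
def AllLp {Ω : Type*} [MeasurableSpace Ω] (P : Measure Ω) (f : Ω → ℝ) : Prop :=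
  ∀ q : NNReal, MemLp f q P

namespace AllLp

variable {Ω : Type*} [MeasurableSpace Ω] {P : Measure Ω} {f g : Ω → ℝ}

theorem const [IsFiniteMeasure P] (a : ℝ) : AllLp P fun _ => a := fun _ => memLp_const a

theorem add (hf : AllLp P f) (hg : AllLp P g) : AllLp P fun s => f s + g s :=
  fun q => (hf q).add (hg q)

theorem sub (hf : AllLp P f) (hg : AllLp P g) : AllLp P fun s => f s - g s :=
  fun q => (hf q).sub (hg q)

theorem const_mul (a : ℝ) (hf : AllLp P f) : AllLp P fun s => a * f s :=
  fun q => (hf q).const_mul a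

theorem div_const (hf : AllLp P f) (a : ℝ) : AllLp P fun s => f s / a := fun q => by
  simpa only [div_eq_inv_mul] using (hf q).const_mul a⁻¹

/-- Hölder with exponents `2q`, `2q`, `q`. -/
theorem mul (hf : AllLp P f) (hg : AllLp P g) : AllLp P fun s => f s * g s := fun q => by
  have h : ENNReal.HolderTriple ((2 * q : NNReal) : ℝ≥0∞) ((2 * q : NNReal) : ℝ≥0∞) (q : ℝ≥0∞) := by
    constructor
    push_cast
    rw [ENNReal.mul_inv (Or.inl two_ne_zero) (Or.inl ENNReal.ofNat_ne_top), ← add_mul,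
      ENNReal.inv_two_add_inv_two, one_mul]
  exact (hg (2 * q)).mul' (hf (2 * q)) (hpqr := h)

theorem pow [IsFiniteMeasure P] (hf : AllLp P f) (n : ℕ) : AllLp P fun s => f s ^ n := by
  induction n with
  | zero => simpa using AllLp.const (P := P) 1
  | succ n ih => simpa only [pow_succ] using ih.mul hf

theorem abs (hf : AllLp P f) : AllLp P fun s => |f s| := fun q => (hf q).abs

theorem sum {ι : Type*} (t : Finset ι) {f : ι → Ω → ℝ} (hf : ∀ i ∈ t, AllLp P (f i)) :
    AllLp P fun s => ∑ i ∈ t, f i s :=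
  fun q => memLp_finsetSum t fun i hi => hf i hi q

theorem indicator {A : Set Ω} (hA : MeasurableSet A) (hf : AllLp P f) : AllLp P (A.indicator f) :=
  fun q => (hf q).indicator hA

theorem integrable (hf : AllLp P f) : Integrable f P := memLp_one_iff_integrable.1 (by
  simpa using hf 1)

theorem aestronglyMeasurable (hf : AllLp P f) : AEStronglyMeasurable f P := (hf 1).1

end AllLp

/-! ### Moments of Gaussian noise and of its predictable transforms -/

/-- A sequence of standard Gaussian variables `ξ 0, ξ 1, …` such that `ξ i` is revealed at time
`i + 1` and is independent of what is known at time `i`. -/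
structure IsGaussianNoise {Ω : Type*} [mΩ : MeasurableSpace Ω] (P : Measure Ω)
    (F : Filtration ℕ mΩ) (ξ : ℕ → Ω → ℝ) : Prop where
  adapted : ∀ i, Measurable[F (i + 1)] (ξ i)
  indep : ∀ i, Indep (F i) (MeasurableSpace.comap (ξ i) inferInstance) P
  law : ∀ i, P.map (ξ i) = gaussianReal 0 1

/-- The average of the first `n` terms, equal to `0` for `n = 0`. -/
noncomputable def runningAvg {Ω : Type*} (ξ : ℕ → Ω → ℝ) (n : ℕ) (s : Ω) : ℝ :=
  (∑ i ∈ Finset.range n, ξ i s) / n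

namespace IsGaussianNoise

variable {Ω : Type*} [mΩ : MeasurableSpace Ω] {P : Measure Ω} [IsProbabilityMeasure P]
  {F : Filtration ℕ mΩ} {ξ : ℕ → Ω → ℝ}

theorem measurable (H : IsGaussianNoise P F ξ) (i : ℕ) : Measurable (ξ i) :=
  (H.adapted i).mono (F.le _) le_rfl

theorem allLp (H : IsGaussianNoise P F ξ) (i : ℕ) : AllLp P (ξ i) := fun q => by
  have h : MemLp id (q : ℝ≥0∞) (P.map (ξ i)) := by rw [H.law i]; exact memLp_id_gaussianReal q
  exact (memLp_map_measure_iff aestronglyMeasurable_id (H.measurable i).aemeasurable).1 h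

theorem integral_comp (H : IsGaussianNoise P F ξ) (i : ℕ) {φ : ℝ → ℝ} (hφ : Measurable φ) :
    ∫ s, φ (ξ i s) ∂P = ∫ x, φ x ∂(gaussianReal 0 1) := by
  rw [← H.law i, integral_map (H.measurable i).aemeasurable hφ.aestronglyMeasurable]

theorem integral_mul_comp (H : IsGaussianNoise P F ξ) (i : ℕ) {φ : ℝ → ℝ} (hφ : Measurable φ)
    {f : Ω → ℝ} (hf : Measurable[F i] f) :
    ∫ s, f s * φ (ξ i s) ∂P = (∫ s, f s ∂P) * ∫ x, φ x ∂(gaussianReal 0 1) := by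
  have hi : IndepFun f (ξ i) P := indep_of_indep_of_le_left (H.indep i) hf.comap_le
  have hi' : IndepFun f (fun s => φ (ξ i s)) P := hi.comp measurable_id hφ
  rw [hi'.integral_fun_mul_eq_mul_integral (hf.mono (F.le _) le_rfl).aestronglyMeasurable
    (hφ.comp (H.measurable i)).aestronglyMeasurable, H.integral_comp i hφ]

theorem integral_mul (H : IsGaussianNoise P F ξ) (i : ℕ)
    {f : Ω → ℝ} (hf : Measurable[F i] f) : ∫ s, f s * ξ i s ∂P = 0 := by
  have h := H.integral_mul_comp i measurable_id hf
  simp only [id] at h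
  rw [h, integral_id_gaussianReal, mul_zero]

theorem integral_sq_gaussianReal : ∫ x, x ^ 2 ∂(gaussianReal 0 1) = 1 := by
  have h := variance_id_gaussianReal (μ := 0) (v := 1)
  rw [variance_eq_integral aemeasurable_id] at h
  simpa [integral_id_gaussianReal] using h

theorem integral_mul_sq (H : IsGaussianNoise P F ξ) (i : ℕ)
    {f : Ω → ℝ} (hf : Measurable[F i] f) : ∫ s, f s * ξ i s ^ 2 ∂P = ∫ s, f s ∂P := by
  rw [H.integral_mul_comp i (φ := fun x => x ^ 2) (by fun_prop) hf, integral_sq_gaussianReal,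
    mul_one]

theorem measurable_sum (H : IsGaussianNoise P F ξ) {g : ℕ → Ω → ℝ}
    (hg : ∀ i, Measurable[F i] (g i)) (n : ℕ) :
    Measurable[F n] fun s => ∑ i ∈ Finset.range n, g i s * ξ i s :=
  Finset.measurable_fun_sum _ fun i hi =>
    ((hg i).mono (F.mono (Finset.mem_range.1 hi).le) le_rfl).mul
      ((H.adapted i).mono (F.mono (Finset.mem_range.1 hi)) le_rfl)

theorem allLp_sum (H : IsGaussianNoise P F ξ) {g : ℕ → Ω → ℝ} (hg : ∀ i, AllLp P (g i)) (n : ℕ) :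
    AllLp P fun s => ∑ i ∈ Finset.range n, g i s * ξ i s :=
  AllLp.sum _ fun i _ => (hg i).mul (H.allLp i)

theorem integral_sum (H : IsGaussianNoise P F ξ) {g : ℕ → Ω → ℝ}
    (hg : ∀ i, Measurable[F i] (g i)) (hg' : ∀ i, AllLp P (g i)) (n : ℕ) :
    ∫ s, ∑ i ∈ Finset.range n, g i s * ξ i s ∂P = 0 := by
  rw [integral_finsetSum _ fun i _ => ((hg' i).mul (H.allLp i)).integrable]
  exact Finset.sum_eq_zero fun i _ => H.integral_mul i (hg i)

/-- Orthogonality of martingale differences: when the last term is split off, the cross term is a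
variable known at time `n` times the independent centred `ξ n`. -/
theorem integral_sum_sq (H : IsGaussianNoise P F ξ) {g : ℕ → Ω → ℝ}
    (hg : ∀ i, Measurable[F i] (g i)) (hg' : ∀ i, AllLp P (g i)) (n : ℕ) :
    ∫ s, (∑ i ∈ Finset.range n, g i s * ξ i s) ^ 2 ∂P
      = ∑ i ∈ Finset.range n, ∫ s, g i s ^ 2 ∂P := by
  induction n with
  | zero => simp
  | succ n ih =>
    rw [Finset.sum_range_succ, ← ih]
    have hM := H.measurable_sum hg n
    have hM' := H.allLp_sum hg' n
    set M : Ω → ℝ := fun s => ∑ i ∈ Finset.range n, g i s * ξ i s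
    have e : ∀ s, (∑ i ∈ Finset.range (n + 1), g i s * ξ i s) ^ 2
        = M s ^ 2 + ((2 * (M s * g n s)) * ξ n s + g n s ^ 2 * ξ n s ^ 2) := fun s => by
      rw [Finset.sum_range_succ]; simp only [M]; ring
    simp only [e]
    have i1 := (((hM'.mul (hg' n)).const_mul 2).mul (H.allLp n)).integrable
    have i2 := (((hg' n).pow 2).mul ((H.allLp n).pow 2)).integrable
    rw [integral_add (hM'.pow 2).integrable (i1.fun_add i2), integral_add i1 i2,
      H.integral_mul n (f := fun s => 2 * (M s * g n s)) ((hM.mul (hg n)).const_mul 2), H.integral_mul_sq n ((hg n).pow_const 2),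
      zero_add]

theorem measurable_partialSum (H : IsGaussianNoise P F ξ) (n : ℕ) :
    Measurable[F n] fun s => ∑ i ∈ Finset.range n, ξ i s := by
  simpa using H.measurable_sum (g := fun _ _ => 1) (fun _ => measurable_const) n

theorem allLp_partialSum (H : IsGaussianNoise P F ξ) (n : ℕ) :
    AllLp P fun s => ∑ i ∈ Finset.range n, ξ i s := AllLp.sum _ fun i _ => H.allLp i

theorem integral_partialSum (H : IsGaussianNoise P F ξ) (n : ℕ) :
    ∫ s, ∑ i ∈ Finset.range n, ξ i s ∂P = 0 := by
  simpa using H.integral_sum (g := fun _ _ => 1) (fun _ => measurable_const)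
    (fun _ => AllLp.const 1) n

theorem integral_partialSum_sq (H : IsGaussianNoise P F ξ) (n : ℕ) :
    ∫ s, (∑ i ∈ Finset.range n, ξ i s) ^ 2 ∂P = n := by
  simpa using H.integral_sum_sq (g := fun _ _ => 1) (fun _ => measurable_const)
    (fun _ => AllLp.const 1) n

/-- In the expansion of `(M + ξ n)^4` the linear term vanishes because `ξ n` is centred and the
cubic one because `M` is. The recursion adds `6n + K`, which `(3 + K)((n+1)² - n²)` dominates. -/
theorem integral_partialSum_pow_four_le (H : IsGaussianNoise P F ξ) (n : ℕ) :
    ∫ s, (∑ i ∈ Finset.range n, ξ i s) ^ 4 ∂P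
      ≤ (3 + ∫ x, x ^ 4 ∂(gaussianReal 0 1)) * (n : ℝ) ^ 2 := by
  set K : ℝ := ∫ x, x ^ 4 ∂(gaussianReal 0 1)
  have hK : 0 ≤ K := integral_nonneg fun x => by positivity
  induction n with
  | zero => simp
  | succ n ih =>
    have hM := H.measurable_partialSum n
    have hM' := H.allLp_partialSum n
    have h0 := H.integral_partialSum n
    have h2 := H.integral_partialSum_sq n
    set M : Ω → ℝ := fun s => ∑ i ∈ Finset.range n, ξ i s
    have e : ∀ s, (∑ i ∈ Finset.range (n + 1), ξ i s) ^ 4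
        = M s ^ 4 + ((4 * M s ^ 3) * ξ n s + ((6 * M s ^ 2) * ξ n s ^ 2
          + ((4 * M s) * ξ n s ^ 3 + ξ n s ^ 4))) := fun s => by
      rw [Finset.sum_range_succ]; simp only [M]; ring
    simp only [e]
    have hξ := H.allLp n
    have i1 := (((hM'.pow 3).const_mul 4).mul hξ).integrable
    have i2 := (((hM'.pow 2).const_mul 6).mul (hξ.pow 2)).integrable
    have i3 := ((hM'.const_mul 4).mul (hξ.pow 3)).integrable
    have i4 := (hξ.pow 4).integrable
    have j3 := H.integral_mul_comp n (φ := fun x => x ^ 3) (by fun_prop) (hM.const_mul 4)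
    have j4 := H.integral_comp n (φ := fun x => x ^ 4) (by fun_prop)
    rw [integral_add (hM'.pow 4).integrable (i1.fun_add (i2.fun_add (i3.fun_add i4))),
      integral_add i1 (i2.fun_add (i3.fun_add i4)), integral_add i2 (i3.fun_add i4), integral_add i3 i4,
      H.integral_mul n ((hM.pow_const 3).const_mul 4),
      H.integral_mul_sq n ((hM.pow_const 2).const_mul 6), j3, j4, integral_const_mul,
      integral_const_mul, h0, h2]
    push_cast
    have hn : (0 : ℝ) ≤ n := Nat.cast_nonneg n
    change _ ≤ (3 + K) * _ at ih
    change (∫ s, M s ^ 4 ∂P) + (0 + (6 * (n : ℝ) + (4 * 0 * _ + K))) ≤ _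
    nlinarith

theorem measurable_runningAvg (H : IsGaussianNoise P F ξ) (n : ℕ) :
    Measurable[F n] (runningAvg ξ n) := (H.measurable_partialSum n).div_const _

theorem allLp_runningAvg (H : IsGaussianNoise P F ξ) (n : ℕ) : AllLp P (runningAvg ξ n) :=
  (H.allLp_partialSum n).div_const _

theorem integral_runningAvg (H : IsGaussianNoise P F ξ) (n : ℕ) :
    ∫ s, runningAvg ξ n s ∂P = 0 := by
  simp only [runningAvg, integral_div, H.integral_partialSum, zero_div]

/-- True at `n = 0` as well, since the empty average and `1 / 0` are both `0`. The variants with `n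
+ 1` below avoid this case in later sums. -/
theorem integral_runningAvg_sq (H : IsGaussianNoise P F ξ) (n : ℕ) :
    ∫ s, runningAvg ξ n s ^ 2 ∂P = 1 / n := by
  simp only [runningAvg, div_pow, integral_div, H.integral_partialSum_sq]
  rcases Nat.eq_zero_or_pos n with rfl | hn
  · simp
  · have : (n : ℝ) ≠ 0 := by positivity
    field_simp

theorem integral_runningAvg_sq_le (H : IsGaussianNoise P F ξ) (n : ℕ) :
    ∫ s, runningAvg ξ n s ^ 2 ∂P ≤ 2 / ((n : ℝ) + 1) := by
  rw [H.integral_runningAvg_sq]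
  rcases Nat.eq_zero_or_pos n with rfl | hn
  · simp
  · have : (1 : ℝ) ≤ n := by exact_mod_cast hn
    rw [div_le_div_iff₀ (by positivity) (by positivity)]
    linarith

theorem integral_runningAvg_pow_four_le (H : IsGaussianNoise P F ξ) (n : ℕ) :
    ∫ s, runningAvg ξ n s ^ 4 ∂P
      ≤ 4 * (3 + ∫ x, x ^ 4 ∂(gaussianReal 0 1)) / ((n : ℝ) + 1) ^ 2 := by
  have h := H.integral_partialSum_pow_four_le n
  have hK : 0 ≤ ∫ x, x ^ 4 ∂(gaussianReal 0 1) := integral_nonneg fun x => by positivity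
  simp only [runningAvg, div_pow, integral_div]
  rcases Nat.eq_zero_or_pos n with rfl | hn
  · simp; positivity
  · have hn1 : (1 : ℝ) ≤ n := by exact_mod_cast hn
    rw [div_le_div_iff₀ (by positivity) (by positivity)]
    have h1 : ((n : ℝ) + 1) ^ 2 ≤ 4 * n ^ 2 := by nlinarith
    calc _ ≤ ((3 + ∫ x, x ^ 4 ∂(gaussianReal 0 1)) * (n : ℝ) ^ 2) * (4 * n ^ 2) := by gcongr
      _ = _ := by ring

/-- One constant serves all `i`; it is used to bound the maximum of `m` noise terms. -/
theorem exists_exp_bound (H : IsGaussianNoise P F ξ) (t : ℝ) :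
    ∃ C, ∀ i, Integrable (fun s => Real.exp (t * ξ i s)) P ∧
      ∫ s, Real.exp (t * ξ i s) ∂P = C := by
  refine ⟨∫ x, Real.exp (t * x) ∂(gaussianReal 0 1), fun i => ⟨?_, ?_⟩⟩
  · have h : Integrable (fun x => Real.exp (t * x)) (P.map (ξ i)) := by
      rw [H.law i]; exact integrable_exp_mul_gaussianReal t
    exact h.comp_measurable (H.measurable i)
  · exact H.integral_comp i (φ := fun x => Real.exp (t * x)) (by fun_prop)

end IsGaussianNoise

/-! ### First passage of a perturbed random walk -/

theorem tsum_nat_add_le_tsum {f g : ℕ → ℝ} (hf0 : ∀ i, 0 ≤ f i) (hf : Summable f)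
    (hg : Summable g) {m : ℕ} (h : ∀ i, g (i + m) ≤ f (i + m)) :
    ∑' i, g (i + m) ≤ ∑' i, f i := by
  have h1 : ∑' i, g (i + m) ≤ ∑' i, f (i + m) :=
    Summable.tsum_le_tsum h ((summable_nat_add_iff m).2 hg) ((summable_nat_add_iff m).2 hf)
  have h2 := hf.sum_add_tsum_nat_add m
  have h3 : 0 ≤ ∑ n ∈ Finset.range m, f n := Finset.sum_nonneg fun n _ => hf0 n
  linarith

/-- The event that the partial sums of `Z` of orders `0, …, i` all lie below `b`. -/
def belowUntil {Ω : Type*} (Z : ℕ → Ω → ℝ) (b : ℝ) (i : ℕ) : Set Ω :=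
  {s | ∀ n ≤ i, ∑ j ∈ Finset.range n, Z j s < b}

/-- Increments `Z i` of a random walk with drift `I` (and no drift at `i = 0`), perturbed by a
martingale difference sequence `D` and a slowly varying term `R`. -/
structure IsPerturbedWalk {Ω : Type*} [mΩ : MeasurableSpace Ω] (P : Measure Ω)
    (F : Filtration ℕ mΩ) (Z D R : ℕ → Ω → ℝ) (I C : ℝ) : Prop where
  drift_pos : 0 < I
  adapted : ∀ i, Measurable[F (i + 1)] (Z i)
  decomp : ∀ i s, Z i s = (if i = 0 then 0 else I) + D i s - R i s
  allLp_incr : ∀ i, AllLp P (Z i)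
  allLp_mart : ∀ i, AllLp P (D i)
  allLp_rem : ∀ i, AllLp P (R i)
  integral_mart : ∀ (m : ℕ) (A : ℕ → Set Ω), (∀ i, MeasurableSet[F i] (A i)) →
    ∫ s, ∑ i ∈ Finset.range m, (A i).indicator (D i) s ∂P = 0
  integral_mart_sq : ∀ (m : ℕ) (A : ℕ → Set Ω), (∀ i, MeasurableSet[F i] (A i)) →
    ∫ s, (∑ i ∈ Finset.range m, (A i).indicator (D i) s) ^ 2 ∂P ≤ C * m
  integral_rem_sq : ∀ i : ℕ, ∫ s, R i s ^ 2 ∂P ≤ C / ((i : ℝ) + 1)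
  integral_incr_sq : ∀ i, ∫ s, Z i s ^ 2 ∂P ≤ C
  overshoot : ∀ η > 0, ∃ K, ∀ m : ℕ, 1 ≤ m → ∃ B : Ω → ℝ, Integrable B P ∧
    (∀ i < m, ∀ s, Z i s ≤ B s) ∧ ∫ s, B s ∂P ≤ η * Real.log m + K
  tail : Summable fun n : ℕ => P.real {s | ∑ j ∈ Finset.range n, Z j s ≤ I * n / 2}

/-- The stopped path: `T` is the number of steps before the level `b` is reached, at most `m`. -/
theorem exists_stopped_path {Ω : Type*} (Z : ℕ → Ω → ℝ) {b : ℝ} (hb : 0 < b) {m : ℕ} (hm : 1 ≤ m)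
    (s : Ω) : ∃ T : ℕ, 1 ≤ T ∧ T ≤ m ∧
      (∀ (f : ℕ → Ω → ℝ), ∑ i ∈ Finset.range m, (belowUntil Z b i).indicator (f i) s
        = ∑ i ∈ Finset.range T, f i s) ∧
      (∀ i < m, (belowUntil Z b i).indicator 1 s = if i < T then (1 : ℝ) else 0) ∧
      min b (∑ i ∈ Finset.range m, Z i s) ≤ ∑ i ∈ Finset.range T, Z i s ∧
      ∑ i ∈ Finset.range (T - 1), Z i s < b := by
  obtain ⟨T, h1, h2, h3, h4, h5⟩ := exists_stop_index (fun n => ∑ j ∈ Finset.range n, Z j s) b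
    (by simpa using hb) m hm
  have h6 : ∀ (f : Ω → ℝ), ∀ i < m, (belowUntil Z b i).indicator f s
      = if i < T then f s else 0 := fun f i hi => by
    simp only [Set.indicator_apply, belowUntil, Set.mem_ofPred_eq, h3 i hi]
  refine ⟨T, h1, h2, fun f => ?_, fun i hi => h6 1 i hi, h4, h5⟩
  rw [← sum_range_ite_lt (fun i => f i s) h2]
  exact Finset.sum_congr rfl fun i hi => h6 (f i) i (Finset.mem_range.1 hi)

namespace IsPerturbedWalk

variable {Ω : Type*} [mΩ : MeasurableSpace Ω] {P : Measure Ω} [IsProbabilityMeasure P]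
  {F : Filtration ℕ mΩ} {Z D R : ℕ → Ω → ℝ} {I C : ℝ}

theorem measurableSet_belowUntil (H : IsPerturbedWalk P F Z D R I C) (b : ℝ) (i : ℕ) :
    MeasurableSet[F i] (belowUntil Z b i) := by
  have : belowUntil Z b i = ⋂ n, ⋂ _ : n ≤ i, {s | ∑ j ∈ Finset.range n, Z j s < b} := by
    ext s; simp [belowUntil]
  rw [this]
  refine MeasurableSet.iInter fun n => MeasurableSet.iInter fun hn => ?_
  have hS : Measurable[F i] fun s => ∑ j ∈ Finset.range n, Z j s :=
    Finset.measurable_fun_sum _ fun j hj =>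
      (H.adapted j).mono (F.mono (by have := Finset.mem_range.1 hj; omega)) le_rfl
  exact hS measurableSet_Iio

theorem const_nonneg (H : IsPerturbedWalk P F Z D R I C) : 0 ≤ C :=
  (integral_nonneg fun _ => sq_nonneg _).trans (H.integral_incr_sq 0)

theorem allLp_stopped (H : IsPerturbedWalk P F Z D R I C) (b : ℝ) {f : ℕ → Ω → ℝ}
    (hf : ∀ i, AllLp P (f i)) (m : ℕ) :
    AllLp P fun s => ∑ i ∈ Finset.range m, (belowUntil Z b i).indicator (f i) s :=
  AllLp.sum _ fun i _ => (hf i).indicator (F.le _ _ (H.measurableSet_belowUntil b i))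

/-- The bound is linear in `m`, the same order as the variance of the martingale part. The remainder
therefore does not spoil the `√m` concentration of the walk. -/
theorem integral_sum_abs_rem_sq (H : IsPerturbedWalk P F Z D R I C) (m : ℕ) :
    ∫ s, (∑ i ∈ Finset.range m, |R i s|) ^ 2 ∂P ≤ 4 * C * m := by
  have hR := H.allLp_rem
  have h1 : AllLp P fun s => 2 * √(m : ℝ) * ∑ i ∈ Finset.range m, √((i : ℝ) + 1) * R i s ^ 2 :=
    (AllLp.sum _ fun i _ => ((hR i).pow 2).const_mul _).const_mul _
  have h2 : AllLp P fun s => (∑ i ∈ Finset.range m, |R i s|) ^ 2 :=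
    (AllLp.sum _ fun i _ => (hR i).abs).pow 2
  refine (integral_mono h2.integrable h1.integrable fun s =>
    sum_abs_sq_le_sqrt_weighted (fun i => R i s) m).trans ?_
  rw [integral_const_mul, integral_finsetSum _ fun i _ => (((hR i).pow 2).const_mul _).integrable]
  simp only [integral_const_mul]
  have h3 : ∑ i ∈ Finset.range m, √((i : ℝ) + 1) * ∫ s, R i s ^ 2 ∂P
      ≤ C * (2 * √(m : ℝ)) := by
    refine le_trans ?_ (mul_le_mul_of_nonneg_left (sum_inv_sqrt_le m) H.const_nonneg)
    rw [Finset.mul_sum]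
    refine Finset.sum_le_sum fun i _ => ?_
    refine (mul_le_mul_of_nonneg_left (H.integral_rem_sq i) (Real.sqrt_nonneg _)).trans
      (le_of_eq ?_)
    have hx : 0 < √((i : ℝ) + 1) := Real.sqrt_pos.2 (by positivity)
    have hx2 : ((i : ℝ) + 1) = √((i : ℝ) + 1) ^ 2 := (Real.sq_sqrt (by positivity)).symm
    nth_rewrite 2 [hx2]
    field_simp
  calc _ ≤ 2 * √(m : ℝ) * (C * (2 * √(m : ℝ))) := mul_le_mul_of_nonneg_left h3 (by positivity)
    _ = 4 * C * √(m : ℝ) ^ 2 := by ring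
    _ = 4 * C * m := by rw [Real.sq_sqrt (Nat.cast_nonneg m)]

/-- The increment at `i = 0` has no drift, hence `T - 1`. -/
theorem sum_incr_eq (H : IsPerturbedWalk P F Z D R I C) {T : ℕ} (hT : 1 ≤ T) (s : Ω) :
    ∑ i ∈ Finset.range T, Z i s
      = I * (T - 1) + ∑ i ∈ Finset.range T, D i s - ∑ i ∈ Finset.range T, R i s := by
  simp only [H.decomp, Finset.sum_add_distrib, Finset.sum_sub_distrib]
  congr 2
  obtain ⟨T, rfl⟩ := Nat.exists_eq_succ_of_ne_zero (by omega : T ≠ 0)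
  rw [Finset.sum_range_succ']
  simp [mul_comm]

theorem sq_sum_sub_drift_le (H : IsPerturbedWalk P F Z D R I C) {m : ℕ} (hm : 1 ≤ m) (s : Ω) :
    (∑ i ∈ Finset.range m, Z i s - I * m) ^ 2
      ≤ 3 * (I ^ 2 + (∑ i ∈ Finset.range m, D i s) ^ 2 + (∑ i ∈ Finset.range m, |R i s|) ^ 2) := by
  rw [H.sum_incr_eq hm]
  have h1 : (∑ i ∈ Finset.range m, R i s) ^ 2 ≤ (∑ i ∈ Finset.range m, |R i s|) ^ 2 := by
    rw [← sq_abs (∑ i ∈ Finset.range m, R i s)]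
    gcongr
    exact Finset.abs_sum_le_sum_abs _ _
  set d := ∑ i ∈ Finset.range m, D i s
  set r := ∑ i ∈ Finset.range m, R i s
  nlinarith [sq_nonneg (I + d), sq_nonneg (d + r), sq_nonneg (I - r)]

theorem integral_sq_sum_sub_drift_le (H : IsPerturbedWalk P F Z D R I C) {m : ℕ} (hm : 1 ≤ m) :
    ∫ s, (∑ i ∈ Finset.range m, Z i s - I * m) ^ 2 ∂P ≤ 3 * (I ^ 2 + 5 * C * m) := by
  have h1 : AllLp P fun s => (∑ i ∈ Finset.range m, D i s) ^ 2 :=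
    (AllLp.sum _ fun i _ => H.allLp_mart i).pow 2
  have h2 : AllLp P fun s => (∑ i ∈ Finset.range m, |R i s|) ^ 2 :=
    (AllLp.sum _ fun i _ => (H.allLp_rem i).abs).pow 2
  have h3 : AllLp P fun s => (∑ i ∈ Finset.range m, Z i s - I * m) ^ 2 :=
    ((AllLp.sum _ fun i _ => H.allLp_incr i).sub (AllLp.const _)).pow 2
  have h0 : AllLp P fun _ => I ^ 2 := AllLp.const _
  refine (integral_mono h3.integrable (((h0.add h1).add h2).const_mul 3).integrable
    fun s => H.sq_sum_sub_drift_le hm s).trans ?_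
  rw [integral_const_mul, integral_add (h0.add h1).integrable h2.integrable,
    integral_add h0.integrable h1.integrable]
  have e1 := H.integral_mart_sq m (fun _ => Set.univ) fun _ => MeasurableSet.univ
  simp only [Set.indicator_univ] at e1
  have e2 := H.integral_sum_abs_rem_sq m
  simp only [integral_const, probReal_univ, one_smul]
  linarith

/-- The number of steps before `b` is reached, truncated at `m`, as a real random variable. -/
noncomputable def stopCount (Z : ℕ → Ω → ℝ) (b : ℝ) (m : ℕ) (s : Ω) : ℝ :=
  ∑ i ∈ Finset.range m, (belowUntil Z b i).indicator (fun _ => (1 : ℝ)) s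

/-- `T` is near `N` because `S_T` is near `b`. An overshoot is at most the last jump `Z (T - 1)`; an
undershoot forces `S_m < b ≤ I m`, so it is at most `I m - S_m`. -/
theorem sq_stopCount_sub_le (H : IsPerturbedWalk P F Z D R I C) {b : ℝ} (hb : 0 < b) {N m : ℕ}
    (hm : 1 ≤ m) (hbm : b ≤ I * m) (hN : |b - I * N| ≤ I) (s : Ω) :
    I ^ 2 * (stopCount Z b m s - N) ^ 2
      ≤ 8 * (∑ i ∈ Finset.range m, Z i s ^ 2 + (∑ i ∈ Finset.range m, Z i s - I * m) ^ 2
        + (∑ i ∈ Finset.range m, (belowUntil Z b i).indicator (D i) s) ^ 2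
        + (∑ i ∈ Finset.range m, |R i s|) ^ 2) + 10 * I ^ 2 := by
  obtain ⟨T, h1, h2, h3, -, h5, h6⟩ := exists_stopped_path Z hb hm s
  have hT : stopCount Z b m s = T := by
    rw [stopCount, h3 fun _ _ => 1]; simp
  rw [hT, h3 D]
  have h7 : (∑ i ∈ Finset.range T, R i s) ^ 2 ≤ (∑ i ∈ Finset.range m, |R i s|) ^ 2 := by
    rw [← sq_abs (∑ i ∈ Finset.range T, R i s)]
    gcongr
    exact (Finset.abs_sum_le_sum_abs _ _).trans (Finset.sum_le_sum_of_subset_of_nonneg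
      (Finset.range_mono h2) fun i _ _ => abs_nonneg _)
  have h8 := H.sum_incr_eq h1 s
  have h9 : (∑ i ∈ Finset.range T, Z i s - b) ^ 2
      ≤ ∑ i ∈ Finset.range m, Z i s ^ 2 + (∑ i ∈ Finset.range m, Z i s - I * m) ^ 2 := by
    have hZ : 0 ≤ ∑ i ∈ Finset.range m, Z i s ^ 2 := Finset.sum_nonneg fun i _ => sq_nonneg _
    rcases le_total b (∑ i ∈ Finset.range T, Z i s) with hle | hle
    · have h10 : Z (T - 1) s ^ 2 ≤ ∑ i ∈ Finset.range m, Z i s ^ 2 :=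
        Finset.single_le_sum (f := fun i => Z i s ^ 2) (fun i _ => sq_nonneg _)
          (Finset.mem_range.2 (by omega))
      have h11 : ∑ i ∈ Finset.range T, Z i s
          = ∑ i ∈ Finset.range (T - 1), Z i s + Z (T - 1) s := by
        rw [← Finset.sum_range_succ, Nat.sub_add_cancel h1]
      nlinarith [sq_nonneg (∑ i ∈ Finset.range m, Z i s - I * m)]
    · rcases le_total b (∑ i ∈ Finset.range m, Z i s) with hle' | hle'
      · rw [min_eq_left hle'] at h5
        have : ∑ i ∈ Finset.range T, Z i s - b = 0 := by linarith
        rw [this]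
        nlinarith [sq_nonneg (∑ i ∈ Finset.range m, Z i s - I * m)]
      · rw [min_eq_right hle'] at h5
        nlinarith
  set x := ∑ i ∈ Finset.range T, Z i s
  set d := ∑ i ∈ Finset.range T, D i s
  set r := ∑ i ∈ Finset.range T, R i s
  -- Squaring this with `(x+y)² ≤ 2x² + 2y²` and a four-term analogue gives the factor `8`, and `8
  -- I² + 2 I² = 10 I²`.
  have h12 : I * (T - N) = (x - b) + I - d + r + (b - I * N) := by linarith
  have h13 : (b - I * N) ^ 2 ≤ I ^ 2 := by
    rw [← sq_abs]; exact pow_le_pow_left₀ (abs_nonneg _) hN 2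
  have h14 : ((x - b) + I - d + r) ^ 2 ≤ 4 * ((x - b) ^ 2 + I ^ 2 + d ^ 2 + r ^ 2) := by
    nlinarith [sq_nonneg (x - b - I), sq_nonneg (x - b + d), sq_nonneg (x - b - r),
      sq_nonneg (I + d), sq_nonneg (I - r), sq_nonneg (d + r)]
  have h15 : I ^ 2 * ((T : ℝ) - N) ^ 2
      ≤ 2 * ((x - b) + I - d + r) ^ 2 + 2 * (b - I * N) ^ 2 := by
    rw [← mul_pow, h12]
    nlinarith [sq_nonneg ((x - b) + I - d + r - (b - I * N))]
  linarith

theorem integral_sq_stopCount_sub_le (H : IsPerturbedWalk P F Z D R I C) {b : ℝ} (hb : 0 < b)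
    {N m : ℕ} (hm : 1 ≤ m) (hbm : b ≤ I * m) (hN : |b - I * N| ≤ I) :
    I ^ 2 * ∫ s, (stopCount Z b m s - N) ^ 2 ∂P ≤ (168 * C + 34 * I ^ 2) * m := by
  have hT : AllLp P (stopCount Z b m) := H.allLp_stopped b (fun _ => AllLp.const 1) m
  have h1 : AllLp P fun s => ∑ i ∈ Finset.range m, Z i s ^ 2 :=
    AllLp.sum _ fun i _ => (H.allLp_incr i).pow 2
  have h2 : AllLp P fun s => (∑ i ∈ Finset.range m, Z i s - I * m) ^ 2 :=
    ((AllLp.sum _ fun i _ => H.allLp_incr i).sub (AllLp.const _)).pow 2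
  have h3 := (H.allLp_stopped b H.allLp_mart m).pow 2
  have h4 : AllLp P fun s => (∑ i ∈ Finset.range m, |R i s|) ^ 2 :=
    (AllLp.sum _ fun i _ => (H.allLp_rem i).abs).pow 2
  have h5 := ((h1.add h2).add h3).add h4
  have h6 : AllLp P fun _ => 10 * I ^ 2 := AllLp.const _
  rw [← integral_const_mul]
  refine (integral_mono (((hT.sub (AllLp.const _)).pow 2).const_mul _).integrable
    ((h5.const_mul 8).add h6).integrable
    fun s => H.sq_stopCount_sub_le hb hm hbm hN s).trans ?_
  rw [integral_add (h5.const_mul 8).integrable h6.integrable, integral_const_mul,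
    integral_add ((h1.add h2).add h3).integrable h4.integrable,
    integral_add (h1.add h2).integrable h3.integrable,
    integral_add h1.integrable h2.integrable,
    integral_finsetSum _ fun i _ => ((H.allLp_incr i).pow 2).integrable]
  have e1 : ∑ i ∈ Finset.range m, ∫ s, Z i s ^ 2 ∂P ≤ m * C := by
    simpa using Finset.sum_le_sum fun i (_ : i ∈ Finset.range m) => H.integral_incr_sq i
  have e2 := H.integral_sq_sum_sub_drift_le hm
  have e3 := H.integral_mart_sq m (belowUntil Z b) (H.measurableSet_belowUntil b)
  have e4 := H.integral_sum_abs_rem_sq m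
  simp only [integral_const, probReal_univ, one_smul]
  have hm' : (1 : ℝ) ≤ m := by exact_mod_cast hm
  nlinarith [mul_le_mul_of_nonneg_left hm' (sq_nonneg I)]

theorem integral_stopCount (H : IsPerturbedWalk P F Z D R I C) (b : ℝ) (m : ℕ) :
    ∫ s, stopCount Z b m s ∂P = ∑ i ∈ Finset.range m, P.real (belowUntil Z b i) := by
  have hA := fun i => F.le _ _ (H.measurableSet_belowUntil b i)
  unfold stopCount
  rw [integral_finsetSum _ fun i _ => ((AllLp.const 1).indicator (hA i)).integrable]
  refine Finset.sum_congr rfl fun i _ => ?_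
  rw [integral_indicator_const _ (hA i), smul_eq_mul, mul_one]

/-- Wald's identity: the events `belowUntil Z b i` are known at time `i`, so the stopped martingale
part has mean zero. -/
theorem integral_stopped_incr (H : IsPerturbedWalk P F Z D R I C) {b : ℝ} (hb : 0 < b) {m : ℕ}
    (hm : 1 ≤ m) :
    ∫ s, ∑ i ∈ Finset.range m, (belowUntil Z b i).indicator (Z i) s ∂P
      = I * (∫ s, stopCount Z b m s ∂P) - I
        - ∫ s, ∑ i ∈ Finset.range m, (belowUntil Z b i).indicator (R i) s ∂P := by
  have hT : AllLp P (stopCount Z b m) := H.allLp_stopped b (fun _ => AllLp.const 1) m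
  have hD := H.allLp_stopped b H.allLp_mart m
  have hR := H.allLp_stopped b H.allLp_rem m
  have e : ∀ s, ∑ i ∈ Finset.range m, (belowUntil Z b i).indicator (Z i) s
      = (I * stopCount Z b m s - I)
        + ∑ i ∈ Finset.range m, (belowUntil Z b i).indicator (D i) s
        - ∑ i ∈ Finset.range m, (belowUntil Z b i).indicator (R i) s := fun s => by
    obtain ⟨T, h1, h2, h3, -⟩ := exists_stopped_path Z hb hm s
    have hT : stopCount Z b m s = T := by
      rw [stopCount, h3 fun _ _ => 1]; simp
    rw [hT, h3 Z, h3 D, h3 R, H.sum_incr_eq h1]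
    ring
  have h1 : AllLp P fun s => I * stopCount Z b m s - I := (hT.const_mul I).sub (AllLp.const I)
  simp only [e]
  rw [integral_sub (h1.add hD).integrable hR.integrable, integral_add h1.integrable hD.integrable,
    integral_sub (hT.const_mul I).integrable (AllLp.const I).integrable, integral_const_mul,
    H.integral_mart m _ (H.measurableSet_belowUntil b)]
  simp

/-- One step before stopping the walk is still below `b`, so it exceeds `b` by at most one
increment, which `B` dominates. -/
theorem integral_stopped_incr_le (H : IsPerturbedWalk P F Z D R I C) {b : ℝ} (hb : 0 < b) {m : ℕ}
    (hm : 1 ≤ m) {B : Ω → ℝ} (hB : Integrable B P)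
    (hZB : ∀ i < m, ∀ s, Z i s ≤ B s) :
    ∫ s, ∑ i ∈ Finset.range m, (belowUntil Z b i).indicator (Z i) s ∂P ≤ b + ∫ s, B s ∂P := by
  have h : ∫ s, (b + B s) ∂P = b + ∫ s, B s ∂P := by
    rw [integral_add (integrable_const b) hB]; simp
  rw [← h]
  refine integral_mono (H.allLp_stopped b H.allLp_incr m).integrable
    ((integrable_const b).add hB) fun s => ?_
  obtain ⟨T, h1, h2, h3, -, h5, h6⟩ := exists_stopped_path Z hb hm s
  have h11 : ∑ i ∈ Finset.range T, Z i s
      = ∑ i ∈ Finset.range (T - 1), Z i s + Z (T - 1) s := by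
    rw [← Finset.sum_range_succ, Nat.sub_add_cancel h1]
  simp only [h3 Z, h11]
  have := hZB (T - 1) (by omega) s
  change _ ≤ b + B s
  linarith

/-- `S_T ≥ min(b, S_m)` and `b ≤ I m / 2`, so the shortfall is at most `(I m - S_m - I m / 2)⁺ ≤
(S_m - I m)² / (2 I m)`. The mean of the latter is bounded because `S_m - I m` has second moment
`O(m)`. -/
theorem le_integral_stopped_incr (H : IsPerturbedWalk P F Z D R I C) {b : ℝ} (hb : 0 < b) {m : ℕ}
    (hm : 1 ≤ m) (hbm : 2 * b ≤ I * m) :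
    b - (3 * I / 2 + 15 * C / (2 * I))
      ≤ ∫ s, ∑ i ∈ Finset.range m, (belowUntil Z b i).indicator (Z i) s ∂P := by
  have hI := H.drift_pos
  have hm' : (1 : ℝ) ≤ m := by exact_mod_cast hm
  have hIm : 0 < I * m := by positivity
  have h2 : AllLp P fun s => (∑ i ∈ Finset.range m, Z i s - I * m) ^ 2 :=
    ((AllLp.sum _ fun i _ => H.allLp_incr i).sub (AllLp.const _)).pow 2
  have h0 : AllLp P fun _ => b := AllLp.const _
  have h3 := h0.sub (h2.div_const (2 * (I * m)))
  have key : ∫ s, (b - (∑ i ∈ Finset.range m, Z i s - I * m) ^ 2 / (2 * (I * m))) ∂P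
      ≤ ∫ s, ∑ i ∈ Finset.range m, (belowUntil Z b i).indicator (Z i) s ∂P := by
    refine integral_mono h3.integrable (H.allLp_stopped b H.allLp_incr m).integrable fun s => ?_
    obtain ⟨T, -, -, h3, -, h5, -⟩ := exists_stopped_path Z hb hm s
    simp only [h3 Z]
    refine le_trans ?_ h5
    set S := ∑ i ∈ Finset.range m, Z i s
    have h6 := pos_part_sub_le_sq_div (y := I * m - S) (d := I * m / 2) (by positivity)
    have h7 : (I * m - S) ^ 2 / (4 * (I * m / 2)) = (S - I * m) ^ 2 / (2 * (I * m)) := by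
      congr 1 <;> ring
    rw [h7] at h6
    refine le_min ?_ ?_
    · have := (le_max_right (I * m - S - I * m / 2) 0).trans h6
      linarith
    · have := (le_max_left (I * m - S - I * m / 2) 0).trans h6
      linarith
  refine le_trans ?_ key
  rw [integral_sub h0.integrable (h2.div_const _).integrable, integral_div]
  have e := H.integral_sq_sum_sub_drift_le hm
  have e2 : (∫ s, (∑ i ∈ Finset.range m, Z i s - I * m) ^ 2 ∂P) / (2 * (I * m))
      ≤ 3 * I / 2 + 15 * C / (2 * I) := by
    rw [div_le_iff₀ (by positivity)]
    have e3 : (3 * I / 2 + 15 * C / (2 * I)) * (2 * (I * m)) = 3 * I ^ 2 * m + 15 * C * m := by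
      field_simp
    rw [e3]
    nlinarith [mul_le_mul_of_nonneg_left hm' (sq_nonneg I)]
  simp only [integral_const, probReal_univ, one_smul]
  linarith

/-- The two sums differ by the `R i` with `i` between `T` and `N`. For these, AM-GM gives `|R i| ≤
(η/2) λ_i R_i² + 1/(2 η λ_i)`. The squares are summed over all `i < 2N` and cost `η·O(log N)`; the
reciprocals sum to a multiple of `(T - N)² / N`, whose mean is bounded. -/
theorem abs_integral_stopped_rem_sub_le (H : IsPerturbedWalk P F Z D R I C) {b : ℝ} (hb : 0 < b)
    {N : ℕ} (hN1 : 1 ≤ N) (hN : |b - I * N| ≤ I) (hbN : b ≤ I * N) {η : ℝ} (hη : 0 < η) :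
    |∫ s, ∑ i ∈ Finset.range (N + N), (belowUntil Z b i).indicator (R i) s ∂P
        - ∑ i ∈ Finset.range N, ∫ s, R i s ∂P|
      ≤ η * (2 * C) * harm (N + N) + 2 * (168 * C + 34 * I ^ 2) / (η * I ^ 2) := by
  have hI := H.drift_pos
  have hm : 1 ≤ N + N := by omega
  have hbm : b ≤ I * ((N + N : ℕ) : ℝ) := by push_cast; nlinarith
  set m := N + N
  have hNm : N ≤ m := by omega
  have hNpos : (0 : ℝ) < N := by exact_mod_cast hN1
  set u : ℕ → Ω → ℝ := fun i s =>
    |(belowUntil Z b i).indicator (fun _ => (1 : ℝ)) s - (if i < N then 1 else 0)|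
  have hu : ∀ i, AllLp P (u i) := fun i =>
    (((AllLp.const 1).indicator (F.le _ _ (H.measurableSet_belowUntil b i))).sub
      (AllLp.const _)).abs
  have hR := H.allLp_rem
  -- This weight makes both sums work: `∑ λ_i / (i+1)` is logarithmic, and `∑ 1/λ_i` between `T` and
  -- `N` is at most `2 (T - N)² / N`.
  set lam : ℕ → ℝ := fun i => (N : ℝ) / (|(i : ℝ) - N| + 1)
  have hlam : ∀ i, 0 < lam i := fun i => by positivity
  have hT : AllLp P (stopCount Z b m) := H.allLp_stopped b (fun _ => AllLp.const 1) m
  have e0 : ∑ i ∈ Finset.range N, ∫ s, R i s ∂P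
      = ∫ s, ∑ i ∈ Finset.range N, R i s ∂P :=
    (integral_finsetSum _ fun i _ => (hR i).integrable).symm
  have hRN : AllLp P fun s => ∑ i ∈ Finset.range N, R i s := AllLp.sum _ fun i _ => hR i
  rw [e0, ← integral_sub (H.allLp_stopped b hR m).integrable hRN.integrable]
  have hV : AllLp P fun s => ∑ i ∈ Finset.range m, lam i * R i s ^ 2 :=
    AllLp.sum _ fun i _ => ((hR i).pow 2).const_mul _
  have hT2 : AllLp P fun s => (stopCount Z b m s - N) ^ 2 := (hT.sub (AllLp.const _)).pow 2
  have hmaj : AllLp P fun s => η / 2 * ∑ i ∈ Finset.range m, lam i * R i s ^ 2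
      + (1 / (η * N)) * (stopCount Z b m s - N) ^ 2 := (hV.const_mul _).add (hT2.const_mul _)
  refine (abs_integral_le_integral_abs).trans ((integral_mono
    ((H.allLp_stopped b hR m).sub hRN).abs.integrable hmaj.integrable fun s => ?_).trans ?_)
  · obtain ⟨T, h1, h2, h3, h4, -, -⟩ := exists_stopped_path Z hb hm s
    have hTs : stopCount Z b m s = T := by
      rw [stopCount, h3 fun _ _ => 1]; simp
    have hbet := sum_between_weight_le h2 hNm
    simp only [hTs, h3 R]
    rw [← sum_range_ite_lt (fun i => R i s) h2, ← sum_range_ite_lt (fun i => R i s) hNm,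
      ← Finset.sum_sub_distrib]
    have h7 : ∀ i ∈ Finset.range m,
        |(if i < T then R i s else 0) - (if i < N then R i s else 0)|
        ≤ η / 2 * (lam i * R i s ^ 2)
          + 1 / (2 * η) * (|(if i < T then (1 : ℝ) else 0) - (if i < N then 1 else 0)|
            * ((|(i : ℝ) - N| + 1) / N)) := fun i _ => by
      have hinv : (|(i : ℝ) - N| + 1) / N = 1 / lam i := by simp only [lam, one_div_div]
      have hl := hlam i
      have amgm : |R i s| ≤ η / 2 * (lam i * R i s ^ 2) + 1 / (2 * η) * (1 * (1 / lam i)) := by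
        have hpos : 0 < 2 * (η * lam i) := by positivity
        have : η / 2 * (lam i * R i s ^ 2) + 1 / (2 * η) * (1 * (1 / lam i))
            = ((η * lam i) ^ 2 * R i s ^ 2 + 1) / (2 * (η * lam i)) := by
          field_simp
        rw [this, le_div_iff₀ hpos, ← sq_abs (R i s)]
        nlinarith [sq_nonneg (η * lam i * |R i s| - 1)]
      have hpos : 0 ≤ η / 2 * (lam i * R i s ^ 2) := by positivity
      rw [hinv]
      by_cases h1 : i < T <;> by_cases h2 : i < N <;>
        simp only [h1, h2, if_true, if_false, sub_self, sub_zero, zero_sub, abs_zero, abs_neg,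
          abs_one, zero_mul, mul_zero, add_zero] <;> assumption
    refine (Finset.abs_sum_le_sum_abs _ _).trans ((Finset.sum_le_sum h7).trans ?_)
    rw [Finset.sum_add_distrib, ← Finset.mul_sum, ← Finset.mul_sum]
    have h8 : 1 / (2 * η) * (2 * ((T : ℝ) - N) ^ 2 / N)
        = 1 / (η * N) * ((T : ℝ) - N) ^ 2 := by field_simp
    rw [← h8]
    gcongr
  · rw [integral_add (hV.const_mul _).integrable (hT2.const_mul _).integrable, integral_const_mul,
      integral_const_mul, integral_finsetSum _ fun i _ => (((hR i).pow 2).const_mul _).integrable]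
    simp only [integral_const_mul]
    have h9 : ∑ i ∈ Finset.range m, lam i * ∫ s, R i s ^ 2 ∂P ≤ C * (3 * harm m) := by
      refine le_trans ?_ (mul_le_mul_of_nonneg_left sum_weight_div_le H.const_nonneg)
      rw [Finset.mul_sum]
      refine Finset.sum_le_sum fun i _ => ?_
      refine (mul_le_mul_of_nonneg_left (H.integral_rem_sq i) (hlam i).le).trans (le_of_eq ?_)
      simp only [lam]
      ring
    have h10 := H.integral_sq_stopCount_sub_le hb hm hbm hN
    have hC := H.const_nonneg
    have hh := harm_nonneg m
    refine add_le_add ?_ ?_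
    · calc _ ≤ η / 2 * (C * (3 * harm m)) := by gcongr
        _ ≤ η * (2 * C) * harm m := by
          have : 0 ≤ η * C * harm m := by positivity
          nlinarith
    · have h11 : ∫ s, (stopCount Z b m s - N) ^ 2 ∂P
          ≤ (168 * C + 34 * I ^ 2) * (2 * N) / I ^ 2 := by
        rw [le_div_iff₀ (by positivity), mul_comm]
        refine h10.trans (le_of_eq ?_)
        simp only [m]; push_cast; ring
      calc _ ≤ 1 / (η * N) * ((168 * C + 34 * I ^ 2) * (2 * N) / I ^ 2) := by gcongr
        _ = _ := by field_simp

theorem real_belowUntil_le {b : ℝ} {i : ℕ} (hbi : 2 * b ≤ I * i) :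
    P.real (belowUntil Z b i) ≤ P.real {s | ∑ j ∈ Finset.range i, Z j s ≤ I * i / 2} := by
  refine measureReal_mono fun s hs => ?_
  have := hs i le_rfl
  simp only [Set.mem_ofPred_eq]
  linarith

theorem summable_belowUntil (H : IsPerturbedWalk P F Z D R I C) (b : ℝ) :
    Summable fun i => P.real (belowUntil Z b i) := by
  obtain ⟨m, hm⟩ := exists_nat_ge (2 * b / I)
  rw [div_le_iff₀ H.drift_pos] at hm
  have ht := H.tail
  have hI := H.drift_pos
  set f : ℕ → ℝ := fun n => P.real {s | ∑ j ∈ Finset.range n, Z j s ≤ I * n / 2} with hf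
  have hle : ∀ i, P.real (belowUntil Z b (i + m)) ≤ f (i + m) := fun i => by
    refine real_belowUntil_le ?_
    have h1 : 0 ≤ I * (i : ℝ) := by positivity
    push_cast
    linarith
  rw [← summable_nat_add_iff m]
  exact Summable.of_nonneg_of_le (fun _ => measureReal_nonneg) hle ((summable_nat_add_iff m).2 ht)

/-- The expected first passage time over the level `b` of a perturbed random walk. -/
theorem expected_passage (H : IsPerturbedWalk P F Z D R I C) {η : ℝ} (hη : 0 < η) :
    ∃ K, ∀ b : ℝ, 0 < b → |I * (∑' i, P.real (belowUntil Z b i)) - b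
        - ∑ i ∈ Finset.range ⌈b / I⌉₊, ∫ s, R i s ∂P|
      ≤ η * Real.log ((2 * ⌈b / I⌉₊ : ℕ) : ℝ) + K := by
  have hI := H.drift_pos
  have hC := H.const_nonneg
  -- Half of `η` is reserved for the stopped remainder and half for the overshoot; `+ 1` keeps the
  -- denominator positive when `C = 0`.
  set δ : ℝ := η / (2 * (2 * C + 1))
  have hδ : 0 < δ := by positivity
  have hδ2 : δ * (2 * C) ≤ η / 2 := by
    simp only [δ]
    rw [div_mul_eq_mul_div, div_le_div_iff₀ (by positivity) (by positivity)]
    nlinarith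
  obtain ⟨K, hK⟩ := H.overshoot (η / 2) (by positivity)
  have ht := H.tail
  set f : ℕ → ℝ := fun n => P.real {s | ∑ j ∈ Finset.range n, Z j s ≤ I * n / 2} with hf
  set q : ℝ := ∑' n, f n
  have hf0 : ∀ n, 0 ≤ f n := fun _ => measureReal_nonneg
  have hq : 0 ≤ q := tsum_nonneg hf0
  refine ⟨|K| + (3 * I / 2 + 15 * C / (2 * I)) + I + η / 2
    + 2 * (168 * C + 34 * I ^ 2) / (δ * I ^ 2) + I * q, fun b hb => ?_⟩
  set N := ⌈b / I⌉₊
  have hN1 : 1 ≤ N := Nat.one_le_ceil_iff.2 (by positivity)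
  have hbN : b ≤ I * N := by
    have := Nat.le_ceil (b / I)
    rw [div_le_iff₀ hI] at this
    linarith
  have hN : |b - I * N| ≤ I := by
    have h1 := Nat.ceil_lt_add_one (show 0 ≤ b / I by positivity)
    have h2 : I * (N : ℝ) < I * (b / I + 1) := mul_lt_mul_of_pos_left h1 hI
    have h3 : I * (b / I + 1) = b + I := by field_simp
    rw [abs_le]
    constructor <;> linarith
  have e2N : 2 * N = N + N := by ring
  rw [e2N]
  have hrem := H.abs_integral_stopped_rem_sub_le hb hN1 hN hbN hδ
  have hm : 1 ≤ N + N := by omega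
  have hbm : 2 * b ≤ I * ((N + N : ℕ) : ℝ) := by push_cast; linarith
  -- Truncation at `2N` ensures `2b ≤ I m`, so that for `i ≥ m` staying below `b` forces `S_i ≤ I i
  -- / 2` and the discarded tail is at most `q` uniformly in `b`.
  set m := N + N
  obtain ⟨B, hB1, hB3, hB4⟩ := hK m hm
  have hup := (H.integral_stopped_incr_le hb hm hB1 hB3)
  have hlow := H.le_integral_stopped_incr hb hm hbm
  have heq := H.integral_stopped_incr hb hm
  rw [H.integral_stopCount] at heq
  have hsum := H.summable_belowUntil b
  have hsplit := hsum.sum_add_tsum_nat_add m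
  have htail0 : 0 ≤ ∑' i, P.real (belowUntil Z b (i + m)) := tsum_nonneg fun _ => measureReal_nonneg
  have htail : ∑' i, P.real (belowUntil Z b (i + m)) ≤ q := by
    have hle : ∀ i, P.real (belowUntil Z b (i + m)) ≤ f (i + m) := fun i => by
      refine real_belowUntil_le ?_
      have h1 : 0 ≤ I * (i : ℝ) := by positivity
      push_cast at hbm ⊢
      linarith
    exact tsum_nat_add_le_tsum hf0 ht hsum hle
  have hlog : 0 ≤ Real.log m := Real.log_natCast_nonneg m
  have hharm := harm_le_one_add_log m
  have hrem2 : δ * (2 * C) * harm m ≤ η / 2 * (1 + Real.log m) :=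
    mul_le_mul hδ2 hharm (harm_nonneg m) (by positivity)
  have hK' := le_abs_self K
  have hK0 := abs_nonneg K
  set τ := ∑' i, P.real (belowUntil Z b i)
  set t := ∑' i, P.real (belowUntil Z b (i + m))
  have hIt : I * t ≤ I * q := mul_le_mul_of_nonneg_left htail hI.le
  have hIt0 : 0 ≤ I * t := by positivity
  have hIq : 0 ≤ I * q := by positivity
  have hk1 : 0 ≤ 3 * I / 2 + 15 * C / (2 * I) := by positivity
  have hk2 : 0 ≤ 2 * (168 * C + 34 * I ^ 2) / (δ * I ^ 2) := by positivity
  have hIτ : I * τ = I * ∑ i ∈ Finset.range m, P.real (belowUntil Z b i) + I * t := by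
    rw [← hsplit]; ring
  have hηlog : 0 ≤ η * Real.log m := by positivity
  clear_value τ t q m δ
  rw [abs_le] at hrem ⊢
  constructor <;> linarith

end IsPerturbedWalk

/-! ### One stream: plug-in coefficients and second moments of fluctuations -/

/-- A constant controlling the fourth moments of Gaussian sums. -/
noncomputable def fourthConst : ℝ := 3 + ∫ x, x ^ 4 ∂(gaussianReal 0 1)

theorem fourthConst_nonneg : 0 ≤ fourthConst :=
  add_nonneg (by norm_num) (integral_nonneg fun x => by positivity)

/-- The plug-in coefficient: it is `0` at time `0`, later `θ` plus `c` times the running average. -/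
noncomputable def plugInCoeff {Ω : Type*} (θ c : ℝ) (ξ : ℕ → Ω → ℝ) (i : ℕ) (s : Ω) : ℝ :=
  if i = 0 then 0 else θ + c * runningAvg ξ i s

/-- The accumulated size of the fluctuations of one stream up to time `n`. -/
noncomputable def fluctuation {Ω : Type*} (ξ : ℕ → Ω → ℝ) (n : ℕ) (s : Ω) : ℝ :=
  |ξ 0 s| + n * runningAvg ξ n s ^ 2 + |∑ i ∈ Finset.range n, runningAvg ξ i s * ξ i s|
    + ∑ i ∈ Finset.range n, runningAvg ξ i s ^ 2

theorem runningAvg_zero {Ω : Type*} (ξ : ℕ → Ω → ℝ) (s : Ω) : runningAvg ξ 0 s = 0 := by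
  simp [runningAvg]

theorem plugInCoeff_eq {Ω : Type*} (θ c : ℝ) (ξ : ℕ → Ω → ℝ) (i : ℕ) (s : Ω) :
    plugInCoeff θ c ξ i s = (if i = 0 then 0 else θ) + c * runningAvg ξ i s := by
  by_cases h : i = 0
  · subst h; simp [plugInCoeff, runningAvg_zero]
  · simp [plugInCoeff, h]

/-- Cauchy–Schwarz with weights `1/(i+1)`. The fourth moment of `ξ̄_i` is `O((i+1)⁻²)`, so the right
side has mean `O((harm n)²)`. -/
theorem sq_sum_sq_le_harm_mul (x : ℕ → ℝ) (n : ℕ) :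
    (∑ i ∈ Finset.range n, x i ^ 2) ^ 2
      ≤ harm n * ∑ i ∈ Finset.range n, ((i : ℝ) + 1) * x i ^ 4 := by
  have h := Finset.sum_mul_sq_le_sq_mul_sq (Finset.range n)
    (fun i => √(1 / ((i : ℝ) + 1))) (fun i => √((i : ℝ) + 1) * x i ^ 2)
  have e1 : ∀ i : ℕ, √(1 / ((i : ℝ) + 1)) * (√((i : ℝ) + 1) * x i ^ 2) = x i ^ 2 := fun i => by
    have : 0 < √((i : ℝ) + 1) := by positivity
    rw [Real.sqrt_div zero_le_one, Real.sqrt_one]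
    field_simp
  have e2 : ∀ i : ℕ, √(1 / ((i : ℝ) + 1)) ^ 2 = 1 / ((i : ℝ) + 1) := fun i =>
    Real.sq_sqrt (by positivity)
  have e3 : ∀ i : ℕ, (√((i : ℝ) + 1) * x i ^ 2) ^ 2 = ((i : ℝ) + 1) * x i ^ 4 := fun i => by
    rw [mul_pow, Real.sq_sqrt (by positivity)]; ring
  simp only [e1, e2, e3] at h
  exact h

theorem sq_sum_fin_le {p : ℕ} (f : Fin p → ℝ) : (∑ k, f k) ^ 2 ≤ p * ∑ k, f k ^ 2 := by
  simpa using sq_sum_le_card_mul_sum_sq (s := (Finset.univ : Finset (Fin p))) (f := f)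

theorem mul_le_eps_add_sq_div {x y ε n : ℝ} (hε : 0 < ε) (hn : 0 < n) :
    x * y ≤ ε * n + x ^ 2 / (4 * ε) * (y ^ 2 / n) := by
  have : ε * n + x ^ 2 / (4 * ε) * (y ^ 2 / n)
      = x * y + (2 * ε * n - x * y) ^ 2 / (4 * ε * n) := by
    field_simp; ring
  rw [this]
  have : 0 ≤ (2 * ε * n - x * y) ^ 2 / (4 * ε * n) := by positivity
  linarith

/-- `1 + u ≤ exp u` at `u = y - log m`. Summing the exponentials over `m` variables bounds their
maximum by `log m` plus an average of exponentials. -/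
theorem le_log_add_exp_div {m : ℕ} (hm : 1 ≤ m) (y : ℝ) :
    y ≤ Real.log m + Real.exp y / m := by
  have hm' : (0 : ℝ) < m := by exact_mod_cast hm
  have h := Real.add_one_le_exp (y - Real.log m)
  rw [Real.exp_sub, Real.exp_log hm'] at h
  linarith

namespace IsGaussianNoise

variable {Ω : Type*} [mΩ : MeasurableSpace Ω] {P : Measure Ω} [IsProbabilityMeasure P]
  {F : Filtration ℕ mΩ} {ξ : ℕ → Ω → ℝ}

theorem measurable_plugInCoeff (H : IsGaussianNoise P F ξ) (θ c : ℝ) (i : ℕ) :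
    Measurable[F i] (plugInCoeff θ c ξ i) := by
  have : plugInCoeff θ c ξ i = fun s => (if i = 0 then 0 else θ) + c * runningAvg ξ i s :=
    funext fun s => plugInCoeff_eq θ c ξ i s
  rw [this]
  exact ((H.measurable_runningAvg i).const_mul c).const_add _

theorem allLp_plugInCoeff (H : IsGaussianNoise P F ξ) (θ c : ℝ) (i : ℕ) :
    AllLp P (plugInCoeff θ c ξ i) := by
  have : plugInCoeff θ c ξ i = fun s => (if i = 0 then 0 else θ) + c * runningAvg ξ i s :=
    funext fun s => plugInCoeff_eq θ c ξ i s
  rw [this]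
  exact (AllLp.const _).add ((H.allLp_runningAvg i).const_mul c)

theorem integral_plugInCoeff_sq_le (H : IsGaussianNoise P F ξ) (θ c : ℝ) (i : ℕ) :
    ∫ s, plugInCoeff θ c ξ i s ^ 2 ∂P ≤ 2 * θ ^ 2 + 4 * c ^ 2 := by
  have h1 : AllLp P fun s => 2 * c ^ 2 * runningAvg ξ i s ^ 2 :=
    ((H.allLp_runningAvg i).pow 2).const_mul _
  have h0 : AllLp P fun _ => 2 * θ ^ 2 := AllLp.const _
  refine (integral_mono ((H.allLp_plugInCoeff θ c i).pow 2).integrable (h0.add h1).integrable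
    fun s => ?_).trans ?_
  · simp only [plugInCoeff_eq]
    have h2 : (if i = 0 then 0 else θ) ^ 2 ≤ θ ^ 2 := by
      split_ifs
      · simpa using sq_nonneg θ
      · exact le_rfl
    nlinarith [sq_nonneg ((if i = 0 then 0 else θ) - c * runningAvg ξ i s)]
  · rw [integral_add h0.integrable h1.integrable]
    have h2 := H.integral_runningAvg_sq_le i
    have h3 : 2 / ((i : ℝ) + 1) ≤ 2 := by
      rw [div_le_iff₀ (by positivity)]
      nlinarith [(Nat.cast_nonneg i : (0 : ℝ) ≤ i)]
    simp only [integral_const_mul, integral_const, probReal_univ, one_smul]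
    nlinarith [mul_le_mul_of_nonneg_left (h2.trans h3) (sq_nonneg c)]

theorem allLp_fluctuation (H : IsGaussianNoise P F ξ) (n : ℕ) : AllLp P (fluctuation ξ n) :=
  (((H.allLp 0).abs.add (((H.allLp_runningAvg n).pow 2).const_mul _)).add
    (H.allLp_sum H.allLp_runningAvg n).abs).add
    (AllLp.sum _ fun i _ => (H.allLp_runningAvg i).pow 2)

theorem integral_fluctuation_sq_le (H : IsGaussianNoise P F ξ) (n : ℕ) :
    ∫ s, fluctuation ξ n s ^ 2 ∂P ≤ (12 + 32 * fourthConst) * (1 + harm n) ^ 2 := by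
  have hA := H.allLp_runningAvg
  have a1 := (H.allLp 0).pow 2
  have a2 : AllLp P fun s => (n : ℝ) ^ 2 * runningAvg ξ n s ^ 4 := ((hA n).pow 4).const_mul _
  have a3 := (H.allLp_sum hA n).pow 2
  have a4 : AllLp P fun s => harm n * ∑ i ∈ Finset.range n, ((i : ℝ) + 1) * runningAvg ξ i s ^ 4 :=
    (AllLp.sum _ fun i _ => ((hA i).pow 4).const_mul _).const_mul _
  refine (integral_mono ((H.allLp_fluctuation n).pow 2).integrable
    ((((a1.add a2).add a3).add a4).const_mul 4).integrable fun s => ?_).trans ?_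
  · have h4 := sq_sum_sq_le_harm_mul (fun i => runningAvg ξ i s) n
    simp only [fluctuation]
    rw [← sq_abs (ξ 0 s), ← sq_abs (∑ i ∈ Finset.range n, runningAvg ξ i s * ξ i s)]
    have h2 : (n : ℝ) ^ 2 * runningAvg ξ n s ^ 4 = (n * runningAvg ξ n s ^ 2) ^ 2 := by ring
    rw [h2]
    generalize |ξ 0 s| = x at *
    generalize (n : ℝ) * runningAvg ξ n s ^ 2 = y at *
    generalize |∑ i ∈ Finset.range n, runningAvg ξ i s * ξ i s| = z at *
    generalize ∑ i ∈ Finset.range n, runningAvg ξ i s ^ 2 = v at *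
    nlinarith [sq_nonneg (x - y), sq_nonneg (x - z), sq_nonneg (x - v), sq_nonneg (y - z),
      sq_nonneg (y - v), sq_nonneg (z - v)]
  · rw [integral_const_mul, integral_add ((a1.add a2).add a3).integrable a4.integrable,
      integral_add (a1.add a2).integrable a3.integrable,
      integral_add a1.integrable a2.integrable, integral_const_mul, integral_const_mul,
      integral_finsetSum _ fun i _ => (((hA i).pow 4).const_mul _).integrable,
      H.integral_sum_sq H.measurable_runningAvg hA]
    simp only [integral_const_mul]
    have hK := fourthConst_nonneg
    have hh := harm_nonneg n
    have e1 : ∫ s, ξ 0 s ^ 2 ∂P = 1 := by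
      rw [H.integral_comp 0 (φ := fun x => x ^ 2) (by fun_prop), integral_sq_gaussianReal]
    have e2 : (n : ℝ) ^ 2 * ∫ s, runningAvg ξ n s ^ 4 ∂P ≤ 4 * fourthConst := by
      refine (mul_le_mul_of_nonneg_left (H.integral_runningAvg_pow_four_le n) (sq_nonneg _)).trans
        ?_
      rw [← fourthConst, mul_div_assoc', div_le_iff₀ (by positivity)]
      have : (n : ℝ) ^ 2 ≤ (n + 1) ^ 2 := by gcongr; linarith
      nlinarith
    have e3 : ∑ i ∈ Finset.range n, ∫ s, runningAvg ξ i s ^ 2 ∂P ≤ 2 * harm n := by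
      rw [harm, Finset.mul_sum]
      refine Finset.sum_le_sum fun i _ => ?_
      rw [mul_one_div]
      exact H.integral_runningAvg_sq_le i
    have e4 : ∑ i ∈ Finset.range n, ((i : ℝ) + 1) * ∫ s, runningAvg ξ i s ^ 4 ∂P
        ≤ 4 * fourthConst * harm n := by
      rw [harm, Finset.mul_sum]
      refine Finset.sum_le_sum fun i _ => ?_
      refine (mul_le_mul_of_nonneg_left (H.integral_runningAvg_pow_four_le i)
        (by positivity)).trans (le_of_eq ?_)
      rw [← fourthConst]
      field_simp
    have e5 := mul_le_mul_of_nonneg_left e4 hh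
    have e6 := mul_nonneg hK hh
    nlinarith [mul_nonneg hK (sq_nonneg (harm n))]

end IsGaussianNoise

/-! ### All streams together: martingale part, drift loss and their moments -/

section Streams

variable {Ω : Type*} [mΩ : MeasurableSpace Ω] {P : Measure Ω} [IsProbabilityMeasure P]
  {F : Filtration ℕ mΩ} {p : ℕ} {ξ : Fin p → ℕ → Ω → ℝ}

/-- The martingale part of the log likelihood ratio increment. -/
noncomputable def martIncr (θ : Fin p → ℝ) (c : ℝ) (ξ : Fin p → ℕ → Ω → ℝ) (i : ℕ) (s : Ω) : ℝ :=
  ∑ k, plugInCoeff (θ k) c (ξ k) i s * ξ k i s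

/-- The loss of drift caused by the estimation error. -/
noncomputable def driftLoss (a : Fin p → ℝ) (c : ℝ) (ξ : Fin p → ℕ → Ω → ℝ) (i : ℕ) (s : Ω) : ℝ :=
  ∑ k, (a k * runningAvg (ξ k) i s + c ^ 2 / 2 * runningAvg (ξ k) i s ^ 2)

/-- The increment of the log likelihood ratio with drift `I`. -/
noncomputable def llrIncr (I : ℝ) (θ a : Fin p → ℝ) (c : ℝ) (ξ : Fin p → ℕ → Ω → ℝ) (i : ℕ)
    (s : Ω) : ℝ :=
  (if i = 0 then 0 else I) + martIncr θ c ξ i s - driftLoss a c ξ i s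

theorem allLp_martIncr (H : ∀ k, IsGaussianNoise P F (ξ k)) (θ : Fin p → ℝ) (c : ℝ) (i : ℕ) :
    AllLp P (martIncr θ c ξ i) :=
  AllLp.sum _ fun k _ => ((H k).allLp_plugInCoeff _ c i).mul ((H k).allLp i)

theorem allLp_driftLoss (H : ∀ k, IsGaussianNoise P F (ξ k)) (a : Fin p → ℝ) (c : ℝ) (i : ℕ) :
    AllLp P (driftLoss a c ξ i) :=
  AllLp.sum _ fun k _ => (((H k).allLp_runningAvg i).const_mul _).add
    ((((H k).allLp_runningAvg i).pow 2).const_mul _)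

theorem allLp_llrIncr (H : ∀ k, IsGaussianNoise P F (ξ k)) (I : ℝ) (θ a : Fin p → ℝ) (c : ℝ)
    (i : ℕ) : AllLp P (llrIncr I θ a c ξ i) :=
  ((AllLp.const _).add (allLp_martIncr H θ c i)).sub (allLp_driftLoss H a c i)

theorem measurable_llrIncr (H : ∀ k, IsGaussianNoise P F (ξ k)) (I : ℝ) (θ a : Fin p → ℝ) (c : ℝ)
    (i : ℕ) : Measurable[F (i + 1)] (llrIncr I θ a c ξ i) := by
  have hm : F i ≤ F (i + 1) := F.mono i.le_succ
  refine Measurable.sub (Measurable.add measurable_const ?_) ?_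
  · exact Finset.measurable_fun_sum _ fun k _ =>
      (((H k).measurable_plugInCoeff _ c i).mono hm le_rfl).mul ((H k).adapted i)
  · refine Finset.measurable_fun_sum _ fun k _ => ?_
    have h := ((H k).measurable_runningAvg i).mono hm le_rfl
    exact (h.const_mul _).add ((h.pow_const 2).const_mul _)

/-- The stopping events depend on all streams, but they are predictable for the common filtration,
so each stream separately remains a predictable transform of its own noise. -/
theorem sum_indicator_martIncr (θ : Fin p → ℝ) (c : ℝ) (A : ℕ → Set Ω) (m : ℕ) (s : Ω) :
    ∑ i ∈ Finset.range m, (A i).indicator (martIncr θ c ξ i) s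
      = ∑ k, ∑ i ∈ Finset.range m, (A i).indicator (plugInCoeff (θ k) c (ξ k) i) s * ξ k i s := by
  rw [Finset.sum_comm]
  refine Finset.sum_congr rfl fun i _ => ?_
  by_cases h : s ∈ A i <;> simp [h, martIncr]

theorem integral_sum_indicator_martIncr (H : ∀ k, IsGaussianNoise P F (ξ k)) (θ : Fin p → ℝ)
    (c : ℝ) (m : ℕ) {A : ℕ → Set Ω} (hA : ∀ i, MeasurableSet[F i] (A i)) :
    ∫ s, ∑ i ∈ Finset.range m, (A i).indicator (martIncr θ c ξ i) s ∂P = 0 := by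
  have h1 : ∀ k i, AllLp P ((A i).indicator (plugInCoeff (θ k) c (ξ k) i)) := fun k i =>
    ((H k).allLp_plugInCoeff _ c i).indicator (F.le _ _ (hA i))
  simp only [sum_indicator_martIncr]
  rw [integral_finsetSum _ fun k _ => ((H k).allLp_sum (h1 k) m).integrable]
  exact Finset.sum_eq_zero fun k _ => (H k).integral_sum
    (fun i => ((H k).measurable_plugInCoeff _ c i).indicator (hA i)) (h1 k) m

theorem integral_sq_sum_indicator_martIncr_le (H : ∀ k, IsGaussianNoise P F (ξ k))
    (θ : Fin p → ℝ) (c : ℝ) (m : ℕ) {A : ℕ → Set Ω} (hA : ∀ i, MeasurableSet[F i] (A i)) :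
    ∫ s, (∑ i ∈ Finset.range m, (A i).indicator (martIncr θ c ξ i) s) ^ 2 ∂P
      ≤ (p * ∑ k, (2 * θ k ^ 2 + 4 * c ^ 2)) * m := by
  have h1 : ∀ k i, AllLp P ((A i).indicator (plugInCoeff (θ k) c (ξ k) i)) := fun k i =>
    ((H k).allLp_plugInCoeff _ c i).indicator (F.le _ _ (hA i))
  simp only [sum_indicator_martIncr]
  have h2 : ∀ k, AllLp P fun s => (∑ i ∈ Finset.range m,
      (A i).indicator (plugInCoeff (θ k) c (ξ k) i) s * ξ k i s) ^ 2 := fun k =>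
    ((H k).allLp_sum (h1 k) m).pow 2
  refine (integral_mono ((AllLp.sum _ fun k _ => (H k).allLp_sum (h1 k) m).pow 2).integrable
    ((AllLp.sum Finset.univ fun k _ => h2 k).const_mul p).integrable fun s => sq_sum_fin_le _).trans ?_
  rw [integral_const_mul, integral_finsetSum _ fun k _ => (h2 k).integrable, mul_assoc,
    Finset.sum_mul]
  refine mul_le_mul_of_nonneg_left (Finset.sum_le_sum fun k _ => ?_) (Nat.cast_nonneg p)
  rw [(H k).integral_sum_sq
    (fun i => ((H k).measurable_plugInCoeff _ c i).indicator (hA i)) (h1 k) m]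
  have h3 : ∀ i ∈ Finset.range m, ∫ s, (A i).indicator (plugInCoeff (θ k) c (ξ k) i) s ^ 2 ∂P
      ≤ 2 * θ k ^ 2 + 4 * c ^ 2 := fun i _ => by
    refine (integral_mono ((h1 k i).pow 2).integrable
      (((H k).allLp_plugInCoeff _ c i).pow 2).integrable fun s => ?_).trans
      ((H k).integral_plugInCoeff_sq_le (θ k) c i)
    by_cases h : s ∈ A i
    · simp [h]
    · simpa [h] using sq_nonneg _
  refine (Finset.sum_le_sum h3).trans (le_of_eq ?_)
  simp only [Finset.sum_const, Finset.card_range, nsmul_eq_mul]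
  ring

theorem integral_driftLoss_sq_le (H : ∀ k, IsGaussianNoise P F (ξ k)) (a : Fin p → ℝ) (c : ℝ)
    (i : ℕ) : ∫ s, driftLoss a c ξ i s ^ 2 ∂P
      ≤ (p * ∑ k, (4 * a k ^ 2 + 2 * c ^ 4 * fourthConst)) / ((i : ℝ) + 1) := by
  have hA := fun k => (H k).allLp_runningAvg i
  have h1 : ∀ k, AllLp P fun s => 2 * a k ^ 2 * runningAvg (ξ k) i s ^ 2 := fun k =>
    ((hA k).pow 2).const_mul _
  have h2 : ∀ k, AllLp P fun s => c ^ 4 / 2 * runningAvg (ξ k) i s ^ 4 := fun k =>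
    ((hA k).pow 4).const_mul _
  refine (integral_mono ((allLp_driftLoss H a c i).pow 2).integrable
    ((AllLp.sum Finset.univ fun k _ => (h1 k).add (h2 k)).const_mul p).integrable fun s => ?_).trans ?_
  · refine (sq_sum_fin_le _).trans ?_
    refine mul_le_mul_of_nonneg_left (Finset.sum_le_sum fun k _ => ?_) (Nat.cast_nonneg p)
    nlinarith [sq_nonneg (a k * runningAvg (ξ k) i s - c ^ 2 / 2 * runningAvg (ξ k) i s ^ 2)]
  · rw [integral_const_mul, integral_finsetSum _ fun k _ => ((h1 k).add (h2 k)).integrable,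
      mul_div_assoc, Finset.sum_div]
    refine mul_le_mul_of_nonneg_left (Finset.sum_le_sum fun k _ => ?_) (Nat.cast_nonneg p)
    rw [integral_add (h1 k).integrable (h2 k).integrable, integral_const_mul, integral_const_mul]
    have e1 := (H k).integral_runningAvg_sq_le i
    have e2 := (H k).integral_runningAvg_pow_four_le i
    rw [← fourthConst] at e2
    have hi : (0 : ℝ) < i + 1 := by positivity
    have e3 : 4 * fourthConst / ((i : ℝ) + 1) ^ 2 ≤ 4 * fourthConst / ((i : ℝ) + 1) := by
      have := fourthConst_nonneg
      refine div_le_div_of_nonneg_left (by positivity) hi ?_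
      nlinarith [(Nat.cast_nonneg i : (0 : ℝ) ≤ i)]
    calc _ ≤ 2 * a k ^ 2 * (2 / ((i : ℝ) + 1))
          + c ^ 4 / 2 * (4 * fourthConst / ((i : ℝ) + 1)) := by
          have : 0 ≤ c ^ 4 := by positivity
          gcongr
          exact e2.trans e3
      _ = _ := by ring

/-- The linear term is centred, so only the variance `1/i` of the running average contributes. This
is the source of the `(pc²/2) log b` term; at `i = 0` both sides are `0`. -/
theorem integral_driftLoss (H : ∀ k, IsGaussianNoise P F (ξ k)) (a : Fin p → ℝ) (c : ℝ)
    (i : ℕ) : ∫ s, driftLoss a c ξ i s ∂P = p * c ^ 2 / 2 * (1 / i) := by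
  have hA := fun k => (H k).allLp_runningAvg i
  unfold driftLoss
  rw [integral_finsetSum _ fun k _ => (((hA k).const_mul _).add
    (((hA k).pow 2).const_mul _)).integrable]
  have : ∀ k, ∫ s, (a k * runningAvg (ξ k) i s + c ^ 2 / 2 * runningAvg (ξ k) i s ^ 2) ∂P
      = c ^ 2 / 2 * (1 / i) := fun k => by
    rw [integral_add ((hA k).const_mul _).integrable (((hA k).pow 2).const_mul _).integrable,
      integral_const_mul, integral_const_mul, (H k).integral_runningAvg,
      (H k).integral_runningAvg_sq, mul_zero, zero_add]
  simp only [this, Finset.sum_const, Finset.card_univ, Fintype.card_fin, nsmul_eq_mul]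
  ring

theorem integral_llrIncr_sq_le (H : ∀ k, IsGaussianNoise P F (ξ k)) (I : ℝ) (θ a : Fin p → ℝ)
    (c : ℝ) (i : ℕ) : ∫ s, llrIncr I θ a c ξ i s ^ 2 ∂P
      ≤ 3 * (I ^ 2 + p * ∑ k, (2 * θ k ^ 2 + 4 * c ^ 2)
        + p * ∑ k, (4 * a k ^ 2 + 2 * c ^ 4 * fourthConst)) := by
  have hD := allLp_martIncr H θ c i
  have hR := allLp_driftLoss H a c i
  have h0 : AllLp P fun _ => I ^ 2 := AllLp.const _
  refine (integral_mono ((allLp_llrIncr H I θ a c i).pow 2).integrable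
    (((h0.add (hD.pow 2)).add (hR.pow 2)).const_mul 3).integrable fun s => ?_).trans ?_
  · simp only [llrIncr]
    have h2 : (if i = 0 then 0 else I) ^ 2 ≤ I ^ 2 := by
      split_ifs
      · simpa using sq_nonneg I
      · exact le_rfl
    generalize (if i = 0 then 0 else I) = x at *
    generalize martIncr θ c ξ i s = y at *
    generalize driftLoss a c ξ i s = z at *
    nlinarith [sq_nonneg (x - y), sq_nonneg (x + z), sq_nonneg (y + z)]
  · rw [integral_const_mul, integral_add (h0.add (hD.pow 2)).integrable (hR.pow 2).integrable,
      integral_add h0.integrable (hD.pow 2).integrable]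
    have e1 := integral_driftLoss_sq_le H a c i
    have e2 : (p * ∑ k, (4 * a k ^ 2 + 2 * c ^ 4 * fourthConst)) / ((i : ℝ) + 1)
        ≤ p * ∑ k, (4 * a k ^ 2 + 2 * c ^ 4 * fourthConst) := by
      have := fourthConst_nonneg
      refine div_le_self (mul_nonneg (Nat.cast_nonneg p)
        (Finset.sum_nonneg fun k _ => by positivity)) ?_
      linarith [(Nat.cast_nonneg i : (0 : ℝ) ≤ i)]
    have e3 : ∫ s, martIncr θ c ξ i s ^ 2 ∂P ≤ p * ∑ k, (2 * θ k ^ 2 + 4 * c ^ 2) := by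
      have h1 : ∀ k, AllLp P fun s => plugInCoeff (θ k) c (ξ k) i s ^ 2 * ξ k i s ^ 2 := fun k =>
        (((H k).allLp_plugInCoeff _ c i).pow 2).mul (((H k).allLp i).pow 2)
      refine (integral_mono (hD.pow 2).integrable
        ((AllLp.sum Finset.univ fun k _ => h1 k).const_mul p).integrable fun s => ?_).trans ?_
      · refine (sq_sum_fin_le _).trans (le_of_eq ?_)
        simp only [mul_pow]
      · rw [integral_const_mul, integral_finsetSum _ fun k _ => (h1 k).integrable]
        refine mul_le_mul_of_nonneg_left (Finset.sum_le_sum fun k _ => ?_) (Nat.cast_nonneg p)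
        rw [(H k).integral_mul_sq i (((H k).measurable_plugInCoeff _ c i).pow_const 2)]
        exact (H k).integral_plugInCoeff_sq_le (θ k) c i
    simp only [integral_const, probReal_univ, one_smul]
    linarith

end Streams

/-! ### Envelope of the increments and summable lower tails -/

section Streams

variable {Ω : Type*} [mΩ : MeasurableSpace Ω] {P : Measure Ω} [IsProbabilityMeasure P]
  {F : Filtration ℕ mΩ} {p : ℕ} {ξ : Fin p → ℕ → Ω → ℝ}

/-- The part of the envelope of the increments that comes from one stream. -/
noncomputable def streamEnvelope (δ θ c : ℝ) (ξ : ℕ → Ω → ℝ) (m : ℕ) (s : Ω) : ℝ :=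
  δ * Real.log m + δ / m * ∑ i ∈ Finset.range m, Real.exp (θ / δ * ξ i s)
    + (|c| / δ + |c| * δ * ∑ i ∈ Finset.range m, runningAvg ξ i s ^ 2 * ξ i s ^ 2)

theorem streamEnvelope_nonneg {δ : ℝ} (hδ : 0 < δ) (θ c : ℝ) (ξ : ℕ → Ω → ℝ) (m : ℕ) (s : Ω) :
    0 ≤ streamEnvelope δ θ c ξ m s := by
  have h1 := Real.log_natCast_nonneg m
  have h2 : 0 ≤ ∑ i ∈ Finset.range m, Real.exp (θ / δ * ξ i s) :=
    Finset.sum_nonneg fun i _ => (Real.exp_pos _).le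
  have h3 : 0 ≤ ∑ i ∈ Finset.range m, runningAvg ξ i s ^ 2 * ξ i s ^ 2 :=
    Finset.sum_nonneg fun i _ => by positivity
  unfold streamEnvelope
  positivity

/-- The term `θ ξ i` is bounded through `le_log_add_exp_div` at scale `θ / δ`, which puts only `δ`
in front of `log m`. The term `c ξ̄_i ξ_i` is bounded by `|y| ≤ 1/δ + δ y²`, where the squares have
a sum of logarithmic mean. -/
theorem plugInCoeff_mul_le_streamEnvelope {δ : ℝ} (hδ : 0 < δ) (θ c : ℝ) (ξ : ℕ → Ω → ℝ)
    {m i : ℕ} (hi : i < m) (s : Ω) :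
    plugInCoeff θ c ξ i s * ξ i s ≤ streamEnvelope δ θ c ξ m s := by
  by_cases h0 : i = 0
  · simpa [plugInCoeff, h0] using streamEnvelope_nonneg hδ θ c ξ m s
  have hm : 1 ≤ m := by omega
  have hm' : (0 : ℝ) < m := by exact_mod_cast hm
  have h1 : Real.exp (θ / δ * ξ i s) ≤ ∑ i ∈ Finset.range m, Real.exp (θ / δ * ξ i s) :=
    Finset.single_le_sum (f := fun i => Real.exp (θ / δ * ξ i s))
      (fun i _ => (Real.exp_pos _).le) (Finset.mem_range.2 hi)
  have h2 : runningAvg ξ i s ^ 2 * ξ i s ^ 2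
      ≤ ∑ i ∈ Finset.range m, runningAvg ξ i s ^ 2 * ξ i s ^ 2 :=
    Finset.single_le_sum (f := fun i => runningAvg ξ i s ^ 2 * ξ i s ^ 2)
      (fun i _ => by positivity) (Finset.mem_range.2 hi)
  have h3 : θ * ξ i s ≤ δ * Real.log m
      + δ / m * ∑ i ∈ Finset.range m, Real.exp (θ / δ * ξ i s) := by
    have h4 := mul_le_mul_of_nonneg_left (le_log_add_exp_div hm (θ / δ * ξ i s)) hδ.le
    have h5 : δ * (θ / δ * ξ i s) = θ * ξ i s := by field_simp
    have h6 : δ / m * Real.exp (θ / δ * ξ i s)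
        ≤ δ / m * ∑ i ∈ Finset.range m, Real.exp (θ / δ * ξ i s) := by gcongr
    have h7 : δ * (Real.log m + Real.exp (θ / δ * ξ i s) / m)
        = δ * Real.log m + δ / m * Real.exp (θ / δ * ξ i s) := by ring
    linarith
  have h4 : c * runningAvg ξ i s * ξ i s ≤ |c| / δ
      + |c| * δ * ∑ i ∈ Finset.range m, runningAvg ξ i s ^ 2 * ξ i s ^ 2 := by
    set y := runningAvg ξ i s * ξ i s with hy
    have h5 : |y| ≤ 1 / δ + δ * y ^ 2 := by
      have : 1 / δ + δ * y ^ 2 = (1 + (δ * y) ^ 2) / δ := by field_simp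
      rw [this, le_div_iff₀ hδ, mul_pow, ← sq_abs y]
      nlinarith [sq_nonneg (δ * |y| - 1), abs_nonneg y, mul_nonneg hδ.le (abs_nonneg y)]
    have h6 : c * y ≤ |c| * |y| := by rw [← abs_mul]; exact le_abs_self _
    have h7 : |c| * |y| ≤ |c| * (1 / δ + δ * y ^ 2) :=
      mul_le_mul_of_nonneg_left h5 (abs_nonneg c)
    have h8 : |c| * δ * y ^ 2
        ≤ |c| * δ * ∑ i ∈ Finset.range m, runningAvg ξ i s ^ 2 * ξ i s ^ 2 := by
      rw [hy, mul_pow]; gcongr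
    have h9 : |c| * (1 / δ + δ * y ^ 2) = |c| / δ + |c| * δ * y ^ 2 := by ring
    rw [mul_assoc]
    linarith
  simp only [plugInCoeff, h0, if_false, streamEnvelope]
  linarith

theorem IsGaussianNoise.streamEnvelope_bound {ξ : ℕ → Ω → ℝ} (H : IsGaussianNoise P F ξ) {δ : ℝ}
    (hδ : 0 < δ) (θ c : ℝ) : ∃ K, ∀ m : ℕ, 1 ≤ m →
      Integrable (streamEnvelope δ θ c ξ m) P ∧
      ∫ s, streamEnvelope δ θ c ξ m s ∂P ≤ δ * (1 + 2 * |c|) * Real.log m + K := by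
  obtain ⟨C, hC⟩ := H.exists_exp_bound (θ / δ)
  refine ⟨δ * C + |c| / δ + 2 * |c| * δ, fun m hm => ?_⟩
  have hm' : (0 : ℝ) < m := by exact_mod_cast hm
  have i1 : Integrable (fun s => ∑ i ∈ Finset.range m, Real.exp (θ / δ * ξ i s)) P :=
    integrable_finsetSum _ fun i _ => (hC i).1
  have i2 : ∀ i, AllLp P fun s => runningAvg ξ i s ^ 2 * ξ i s ^ 2 := fun i =>
    ((H.allLp_runningAvg i).pow 2).mul ((H.allLp i).pow 2)
  have i3 : AllLp P fun s => |c| / δ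
      + |c| * δ * ∑ i ∈ Finset.range m, runningAvg ξ i s ^ 2 * ξ i s ^ 2 :=
    (AllLp.const _).add ((AllLp.sum _ fun i _ => i2 i).const_mul _)
  have i4 : Integrable (fun s => δ * Real.log m
      + δ / m * ∑ i ∈ Finset.range m, Real.exp (θ / δ * ξ i s)) P :=
    (integrable_const _).add (i1.const_mul _)
  refine ⟨i4.add i3.integrable, ?_⟩
  unfold streamEnvelope
  rw [integral_add i4 i3.integrable, integral_add (integrable_const _) (i1.const_mul _),
    integral_add (integrable_const _) ((AllLp.sum _ fun i _ => i2 i).const_mul _).integrable,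
    integral_const_mul (δ / m), integral_const_mul (|c| * δ),
    integral_finsetSum _ fun i _ => (hC i).1,
    integral_finsetSum _ fun i _ => (i2 i).integrable]
  have e1 : ∀ i, ∫ s, runningAvg ξ i s ^ 2 * ξ i s ^ 2 ∂P ≤ 2 * (1 / ((i : ℝ) + 1)) := fun i => by
    rw [H.integral_mul_sq i ((H.measurable_runningAvg i).pow_const 2), mul_one_div]
    exact H.integral_runningAvg_sq_le i
  have e2 : ∑ i ∈ Finset.range m, ∫ s, runningAvg ξ i s ^ 2 * ξ i s ^ 2 ∂P
      ≤ 2 * (1 + Real.log m) := by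
    refine (Finset.sum_le_sum fun i _ => e1 i).trans ?_
    rw [← Finset.mul_sum]
    exact mul_le_mul_of_nonneg_left (harm_le_one_add_log m) zero_le_two
  have e3 : ∑ i ∈ Finset.range m, ∫ s, Real.exp (θ / δ * ξ i s) ∂P = m * C := by
    simp [fun i => (hC i).2]
  have e4 : δ / m * (m * C) = δ * C := by field_simp
  rw [e3, e4]
  have e5 := mul_le_mul_of_nonneg_left e2 (show 0 ≤ |c| * δ by positivity)
  simp only [integral_const, probReal_univ, one_smul]
  linarith

theorem llrIncr_le_envelope {I : ℝ} (hI : 0 < I) (θ a : Fin p → ℝ) (c : ℝ) {δ : ℝ} (hδ : 0 < δ)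
    {m i : ℕ} (hi : i < m) (s : Ω) :
    llrIncr I θ a c ξ i s ≤ I + ∑ k, streamEnvelope δ (θ k) c (ξ k) m s
      + (1 / δ + δ * ∑ i ∈ Finset.range m, driftLoss a c ξ i s ^ 2) := by
  have h1 : (if i = 0 then 0 else I) ≤ I := by split_ifs <;> linarith
  have h2 : martIncr θ c ξ i s ≤ ∑ k, streamEnvelope δ (θ k) c (ξ k) m s :=
    Finset.sum_le_sum fun k _ => plugInCoeff_mul_le_streamEnvelope hδ _ c _ hi s
  have h3 : driftLoss a c ξ i s ^ 2 ≤ ∑ i ∈ Finset.range m, driftLoss a c ξ i s ^ 2 :=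
    Finset.single_le_sum (f := fun i => driftLoss a c ξ i s ^ 2)
      (fun i _ => by positivity) (Finset.mem_range.2 hi)
  have h4 : -driftLoss a c ξ i s ≤ 1 / δ + δ * driftLoss a c ξ i s ^ 2 := by
    set y := driftLoss a c ξ i s
    have : 1 / δ + δ * y ^ 2 = (1 + (δ * y) ^ 2) / δ := by field_simp
    rw [this, le_div_iff₀ hδ]
    nlinarith [sq_nonneg (δ * y + 1), sq_nonneg (δ * y)]
  have h5 := mul_le_mul_of_nonneg_left h3 hδ.le
  unfold llrIncr
  linarith

theorem exists_envelope (H : ∀ k, IsGaussianNoise P F (ξ k)) {I : ℝ} (hI : 0 < I)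
    (θ a : Fin p → ℝ) (c : ℝ) {η : ℝ} (hη : 0 < η) :
    ∃ K, ∀ m : ℕ, 1 ≤ m → ∃ B : Ω → ℝ, Integrable B P ∧
      (∀ i < m, ∀ s, llrIncr I θ a c ξ i s ≤ B s) ∧ ∫ s, B s ∂P ≤ η * Real.log m + K := by
  set C : ℝ := p * ∑ k, (4 * a k ^ 2 + 2 * c ^ 4 * fourthConst) with hC
  have hC0 : 0 ≤ C := by
    have := fourthConst_nonneg
    exact mul_nonneg (Nat.cast_nonneg p) (Finset.sum_nonneg fun k _ => by positivity)
  -- `L - 1` collects the coefficients of `δ log m` from the `p` streams and from the drift loss.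
  set L : ℝ := p * (1 + 2 * |c|) + C + 1
  have hL : 0 < L := by positivity
  set δ := η / L
  have hδ : 0 < δ := by positivity
  choose K hK using fun k => (H k).streamEnvelope_bound hδ (θ k) c
  refine ⟨I + ∑ k, K k + 1 / δ + δ * C, fun m hm => ?_⟩
  have hR := allLp_driftLoss H a c
  have i1 : Integrable (fun s => ∑ k, streamEnvelope δ (θ k) c (ξ k) m s) P :=
    integrable_finsetSum _ fun k _ => (hK k m hm).1
  have i2 : AllLp P fun s => 1 / δ + δ * ∑ i ∈ Finset.range m, driftLoss a c ξ i s ^ 2 :=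
    (AllLp.const _).add ((AllLp.sum _ fun i _ => (hR i).pow 2).const_mul _)
  have i3 : Integrable (fun s => I + ∑ k, streamEnvelope δ (θ k) c (ξ k) m s) P :=
    (integrable_const _).add i1
  refine ⟨_, i3.fun_add i2.integrable, fun i hi s => llrIncr_le_envelope hI θ a c hδ hi s, ?_⟩
  rw [integral_add i3 i2.integrable, integral_add (integrable_const _) i1,
    integral_add (integrable_const _) ((AllLp.sum _ fun i _ => (hR i).pow 2).const_mul _).integrable,
    integral_const_mul δ, integral_finsetSum _ fun k _ => (hK k m hm).1,
    integral_finsetSum _ fun i _ => ((hR i).pow 2).integrable]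
  have e1 : ∑ k, ∫ s, streamEnvelope δ (θ k) c (ξ k) m s ∂P
      ≤ p * (δ * (1 + 2 * |c|) * Real.log m) + ∑ k, K k := by
    refine (Finset.sum_le_sum fun k _ => (hK k m hm).2).trans (le_of_eq ?_)
    simp [Finset.sum_add_distrib]
  have e2 : ∑ i ∈ Finset.range m, ∫ s, driftLoss a c ξ i s ^ 2 ∂P ≤ C * (1 + Real.log m) := by
    refine (Finset.sum_le_sum fun i _ => (integral_driftLoss_sq_le H a c i).trans_eq
      (mul_one_div C _).symm).trans ?_
    rw [← Finset.mul_sum]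
    exact mul_le_mul_of_nonneg_left (harm_le_one_add_log m) hC0
  have e3 := mul_le_mul_of_nonneg_left e2 hδ.le
  have e4 : η = δ * L := by simp only [δ]; field_simp
  have e5 : 0 ≤ δ * Real.log m := mul_nonneg hδ.le (Real.log_natCast_nonneg m)
  have e6 : η * Real.log m = p * (δ * (1 + 2 * |c|) * Real.log m) + δ * C * Real.log m
      + δ * Real.log m := by rw [e4]; simp only [L]; ring
  simp only [integral_const, probReal_univ, one_smul]
  rw [e6]
  linarith

/-- Chebyshev applied to `S_n` itself would give only `O(1/n)`, which is not summable. The linear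
terms of size `√n` are therefore traded, by AM-GM, for `ε n` plus squares divided by `n`. What
remains has an `L²` norm of order `log n`. The term `|ξ 0|` arises because the coefficient at time
`0` is `0` instead of `θ`. -/
theorem sub_sum_llrIncr_le {I : ℝ} (θ a : Fin p → ℝ) (c : ℝ) {ε : ℝ} (hε : 0 < ε) {L : ℝ}
    (hL : ∀ k, |θ k| + |c| + θ k ^ 2 / (4 * ε) + a k ^ 2 / (4 * ε) + c ^ 2 / 2 ≤ L) {n : ℕ}
    (hn : 1 ≤ n) (s : Ω) :
    I * n - ∑ i ∈ Finset.range n, llrIncr I θ a c ξ i s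
      ≤ 2 * p * (ε * n) + (I + L * ∑ k, fluctuation (ξ k) n s) := by
  have hn' : (0 : ℝ) < n := by exact_mod_cast hn
  have hJ : ∑ i ∈ Finset.range n, (if i = 0 then 0 else I) = I * n - I := by
    obtain ⟨n, rfl⟩ := Nat.exists_eq_succ_of_ne_zero (by omega : n ≠ 0)
    rw [Finset.sum_range_succ']
    simp; ring
  have hD : ∑ i ∈ Finset.range n, martIncr θ c ξ i s
      = ∑ k, (θ k * (n * runningAvg (ξ k) n s) - θ k * ξ k 0 s
        + c * ∑ i ∈ Finset.range n, runningAvg (ξ k) i s * ξ k i s) := by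
    unfold martIncr
    rw [Finset.sum_comm]
    refine Finset.sum_congr rfl fun k _ => ?_
    have h1 : (n : ℝ) * runningAvg (ξ k) n s = ∑ i ∈ Finset.range n, ξ k i s := by
      unfold runningAvg; field_simp
    have h2 : ∑ i ∈ Finset.range n, (if i = 0 then 0 else θ k) * ξ k i s
        = θ k * ∑ i ∈ Finset.range n, ξ k i s - θ k * ξ k 0 s := by
      obtain ⟨n, rfl⟩ := Nat.exists_eq_succ_of_ne_zero (by omega : n ≠ 0)
      rw [Finset.sum_range_succ', Finset.sum_range_succ']
      simp [Finset.mul_sum, mul_add]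
    rw [h1, ← h2, Finset.mul_sum, ← Finset.sum_add_distrib]
    exact Finset.sum_congr rfl fun i _ => by rw [plugInCoeff_eq]; ring
  have hR : ∑ i ∈ Finset.range n, driftLoss a c ξ i s
      = ∑ k, (a k * (∑ i ∈ Finset.range n, runningAvg (ξ k) i s)
        + c ^ 2 / 2 * ∑ i ∈ Finset.range n, runningAvg (ξ k) i s ^ 2) := by
    unfold driftLoss
    rw [Finset.sum_comm]
    refine Finset.sum_congr rfl fun k _ => ?_
    rw [Finset.sum_add_distrib, Finset.mul_sum, Finset.mul_sum]
  have key : ∀ k, -(θ k * (n * runningAvg (ξ k) n s) - θ k * ξ k 0 s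
        + c * ∑ i ∈ Finset.range n, runningAvg (ξ k) i s * ξ k i s)
      + (a k * (∑ i ∈ Finset.range n, runningAvg (ξ k) i s)
        + c ^ 2 / 2 * ∑ i ∈ Finset.range n, runningAvg (ξ k) i s ^ 2)
      ≤ 2 * (ε * n) + L * fluctuation (ξ k) n s := fun k => by
    have h1 := mul_le_eps_add_sq_div (x := -θ k) (y := n * runningAvg (ξ k) n s) hε hn'
    have h1' : ((n : ℝ) * runningAvg (ξ k) n s) ^ 2 / n = n * runningAvg (ξ k) n s ^ 2 := by
      field_simp
    have h2 := mul_le_eps_add_sq_div (x := a k)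
      (y := ∑ i ∈ Finset.range n, runningAvg (ξ k) i s) hε hn'
    have h2' : (∑ i ∈ Finset.range n, runningAvg (ξ k) i s) ^ 2 / n
        ≤ ∑ i ∈ Finset.range n, runningAvg (ξ k) i s ^ 2 := by
      rw [div_le_iff₀ hn', mul_comm]
      simpa using sq_sum_le_card_mul_sum_sq (s := Finset.range n)
        (f := fun i => runningAvg (ξ k) i s)
    have h3 : θ k * ξ k 0 s ≤ |θ k| * |ξ k 0 s| := by rw [← abs_mul]; exact le_abs_self _
    have h4 : -(c * ∑ i ∈ Finset.range n, runningAvg (ξ k) i s * ξ k i s)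
        ≤ |c| * |∑ i ∈ Finset.range n, runningAvg (ξ k) i s * ξ k i s| := by
      rw [← abs_mul]; exact neg_le_abs _
    rw [h1', neg_sq] at h1
    have hV : 0 ≤ ∑ i ∈ Finset.range n, runningAvg (ξ k) i s ^ 2 :=
      Finset.sum_nonneg fun i _ => sq_nonneg _
    have hL := hL k
    have t1 : 0 ≤ θ k ^ 2 / (4 * ε) := by positivity
    have t2 : 0 ≤ a k ^ 2 / (4 * ε) := by positivity
    have t3 : 0 ≤ c ^ 2 / 2 := by positivity
    have t4 := abs_nonneg (θ k)
    have t5 := abs_nonneg c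
    have h2'' := mul_le_mul_of_nonneg_left h2' t2
    have b1 : |θ k| * |ξ k 0 s| ≤ L * |ξ k 0 s| :=
      mul_le_mul_of_nonneg_right (by linarith) (abs_nonneg _)
    have b2 : θ k ^ 2 / (4 * ε) * (n * runningAvg (ξ k) n s ^ 2)
        ≤ L * (n * runningAvg (ξ k) n s ^ 2) :=
      mul_le_mul_of_nonneg_right (by linarith) (by positivity)
    have b3 : |c| * |∑ i ∈ Finset.range n, runningAvg (ξ k) i s * ξ k i s|
        ≤ L * |∑ i ∈ Finset.range n, runningAvg (ξ k) i s * ξ k i s| :=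
      mul_le_mul_of_nonneg_right (by linarith) (abs_nonneg _)
    have b4 : (a k ^ 2 / (4 * ε) + c ^ 2 / 2) * ∑ i ∈ Finset.range n, runningAvg (ξ k) i s ^ 2
        ≤ L * ∑ i ∈ Finset.range n, runningAvg (ξ k) i s ^ 2 :=
      mul_le_mul_of_nonneg_right (by linarith) hV
    unfold fluctuation
    linarith
  have hsum := Finset.sum_le_sum fun k (_ : k ∈ (Finset.univ : Finset (Fin p))) => key k
  simp only [Finset.sum_add_distrib, Finset.sum_neg_distrib, ← Finset.mul_sum, Finset.sum_const,
    Finset.card_univ, Fintype.card_fin, nsmul_eq_mul] at hsum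
  simp only [llrIncr, Finset.sum_add_distrib, Finset.sum_sub_distrib, hJ, hD, hR,
    ← Finset.mul_sum] at hsum ⊢
  linarith

theorem summable_real_sum_llrIncr_le (H : ∀ k, IsGaussianNoise P F (ξ k)) {I : ℝ} (hI : 0 < I)
    (θ a : Fin p → ℝ) (c : ℝ) : Summable fun n : ℕ =>
      P.real {s | ∑ j ∈ Finset.range n, llrIncr I θ a c ξ j s ≤ I * n / 2} := by
  -- With `2pε ≤ I/4`, a deficit of `I n / 2` leaves at least `I n / 4` to the fluctuation term, and
  -- Chebyshev gives `O((1 + harm n)² / n²)`.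
  set ε := I / (8 * (p + 1))
  have hε : 0 < ε := by positivity
  have hpε : 2 * p * ε ≤ I / 4 := by
    simp only [ε]
    rw [mul_div_assoc', div_le_div_iff₀ (by positivity) (by positivity)]
    nlinarith
  set L := ∑ k, (|θ k| + |c| + θ k ^ 2 / (4 * ε) + a k ^ 2 / (4 * ε) + c ^ 2 / 2)
  have hL : ∀ k, |θ k| + |c| + θ k ^ 2 / (4 * ε) + a k ^ 2 / (4 * ε) + c ^ 2 / 2 ≤ L := fun k =>
    Finset.single_le_sum
      (f := fun k => |θ k| + |c| + θ k ^ 2 / (4 * ε) + a k ^ 2 / (4 * ε) + c ^ 2 / 2)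
      (fun k _ => by positivity) (Finset.mem_univ k)
  set K : ℝ := 2 * I ^ 2 + 2 * L ^ 2 * (p * ∑ _k : Fin p, (12 + 32 * fourthConst))
  have hf4 := fourthConst_nonneg
  have hK : 0 ≤ K := by positivity
  have hU : ∀ n : ℕ, 1 ≤ n →
      P.real {s | ∑ j ∈ Finset.range n, llrIncr I θ a c ξ j s ≤ I * n / 2}
        ≤ 64 * K / I ^ 2 * ((1 + harm n) ^ 2 / ((n : ℝ) + 1) ^ 2) := fun n hn => by
    have hn' : (1 : ℝ) ≤ n := by exact_mod_cast hn
    have hfl := fun k => (H k).allLp_fluctuation n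
    have hUL : AllLp P fun s => (I + L * ∑ k, fluctuation (ξ k) n s) ^ 2 :=
      ((AllLp.const I).add ((AllLp.sum _ fun k _ => hfl k).const_mul L)).pow 2
    have hcheb := mul_meas_ge_le_integral_of_nonneg
      (Eventually.of_forall fun s => sq_nonneg (I + L * ∑ k, fluctuation (ξ k) n s))
      hUL.integrable ((I * n / 4) ^ 2)
    have hsub : P.real {s | ∑ j ∈ Finset.range n, llrIncr I θ a c ξ j s ≤ I * n / 2}
        ≤ P.real {s | (I * n / 4) ^ 2 ≤ (I + L * ∑ k, fluctuation (ξ k) n s) ^ 2} := by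
      refine measureReal_mono fun s hs => ?_
      simp only [Set.mem_ofPred_eq] at hs ⊢
      refine pow_le_pow_left₀ (by positivity) ?_ 2
      have h1 := sub_sum_llrIncr_le (I := I) (ξ := ξ) θ a c hε hL hn s
      have h2 : 2 * p * (ε * n) ≤ I / 4 * n := by
        rw [← mul_assoc]; exact mul_le_mul_of_nonneg_right hpε (by positivity)
      linarith
    have hint : ∫ s, (I + L * ∑ k, fluctuation (ξ k) n s) ^ 2 ∂P ≤ K * (1 + harm n) ^ 2 := by
      have h0 : AllLp P fun _ => 2 * I ^ 2 := AllLp.const _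
      have h1 : AllLp P fun s => 2 * L ^ 2 * (p * ∑ k, fluctuation (ξ k) n s ^ 2) :=
        ((AllLp.sum Finset.univ fun k _ => (hfl k).pow 2).const_mul _).const_mul _
      refine (integral_mono hUL.integrable (h0.add h1).integrable fun s => ?_).trans ?_
      · have h2 := mul_le_mul_of_nonneg_left (sq_sum_fin_le fun k => fluctuation (ξ k) n s)
          (sq_nonneg L)
        simp only
        nlinarith [sq_nonneg (I - L * ∑ k, fluctuation (ξ k) n s)]
      · rw [integral_add h0.integrable h1.integrable, integral_const_mul (2 * L ^ 2),
          integral_const_mul (p : ℝ),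
          integral_finsetSum _ fun k _ => ((hfl k).pow 2).integrable]
        have h2 : ∑ k, ∫ s, fluctuation (ξ k) n s ^ 2 ∂P
            ≤ (∑ _k : Fin p, (12 + 32 * fourthConst)) * (1 + harm n) ^ 2 := by
          rw [Finset.sum_mul]
          exact Finset.sum_le_sum fun k _ => (H k).integral_fluctuation_sq_le n
        have h3 : (1 : ℝ) ≤ (1 + harm n) ^ 2 := one_le_pow₀ (by linarith [harm_nonneg n])
        have h4 : 2 * L ^ 2 * (p * ∑ k, ∫ s, fluctuation (ξ k) n s ^ 2 ∂P)
            ≤ 2 * L ^ 2 * (p * ((∑ _k : Fin p, (12 + 32 * fourthConst)) * (1 + harm n) ^ 2)) := by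
          gcongr
        have h5 : K * (1 + harm n) ^ 2 = 2 * I ^ 2 * (1 + harm n) ^ 2
            + 2 * L ^ 2 * (p * ((∑ _k : Fin p, (12 + 32 * fourthConst)) * (1 + harm n) ^ 2)) := by
          simp only [K]; ring
        have h6 := mul_le_mul_of_nonneg_left h3 (show 0 ≤ 2 * I ^ 2 by positivity)
        rw [h5]
        simp only [integral_const, probReal_univ, one_smul]
        linarith
    have hx := measureReal_nonneg (μ := P)
      (s := {s | (I * n / 4) ^ 2 ≤ (I + L * ∑ k, fluctuation (ξ k) n s) ^ 2})
    refine hsub.trans ?_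
    rw [div_mul_div_comm, le_div_iff₀ (by positivity)]
    have hn2 : ((n : ℝ) + 1) ^ 2 ≤ 4 * n ^ 2 := by nlinarith
    generalize P.real {s | (I * n / 4) ^ 2 ≤ (I + L * ∑ k, fluctuation (ξ k) n s) ^ 2} = x at *
    calc x * (I ^ 2 * ((n : ℝ) + 1) ^ 2) ≤ x * (I ^ 2 * (4 * n ^ 2)) := by gcongr
      _ = 64 * ((I * n / 4) ^ 2 * x) := by ring
      _ ≤ 64 * (K * (1 + harm n) ^ 2) := by linarith
      _ = _ := by ring
  rw [← summable_nat_add_iff 1]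
  refine Summable.of_nonneg_of_le (fun _ => measureReal_nonneg) (fun n => hU (n + 1) (by omega)) ?_
  exact (summable_nat_add_iff 1).2 (summable_harm_sq_div.mul_left (64 * K / I ^ 2))

theorem exists_isPerturbedWalk (H : ∀ k, IsGaussianNoise P F (ξ k)) {I : ℝ} (hI : 0 < I)
    (θ a : Fin p → ℝ) (c : ℝ) :
    ∃ C, IsPerturbedWalk P F (llrIncr I θ a c ξ) (martIncr θ c ξ) (driftLoss a c ξ) I C := by
  set C1 : ℝ := p * ∑ k, (2 * θ k ^ 2 + 4 * c ^ 2) with hC1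
  set C2 : ℝ := p * ∑ k, (4 * a k ^ 2 + 2 * c ^ 4 * fourthConst) with hC2
  have hf4 := fourthConst_nonneg
  have h1 : 0 ≤ C1 := mul_nonneg (Nat.cast_nonneg p) (Finset.sum_nonneg fun k _ => by positivity)
  have h2 : 0 ≤ C2 := mul_nonneg (Nat.cast_nonneg p) (Finset.sum_nonneg fun k _ => by positivity)
  have h3 := sq_nonneg I
  refine ⟨3 * (I ^ 2 + C1 + C2), hI, measurable_llrIncr H I θ a c, fun _ _ => rfl,
    allLp_llrIncr H I θ a c, allLp_martIncr H θ c, allLp_driftLoss H a c,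
    fun m A hA => integral_sum_indicator_martIncr H θ c m hA, fun m A hA => ?_, fun i => ?_,
    integral_llrIncr_sq_le H I θ a c, fun η hη => exists_envelope H hI θ a c hη,
    summable_real_sum_llrIncr_le H hI θ a c⟩
  · refine (integral_sq_sum_indicator_martIncr_le H θ c m hA).trans ?_
    exact mul_le_mul_of_nonneg_right (by linarith) (Nat.cast_nonneg m)
  · refine (integral_driftLoss_sq_le H a c i).trans ?_
    exact div_le_div_of_nonneg_right (by linarith) (by positivity)

end Streams

/-! ### From the observations to the perturbed walk -/

theorem sum_Icc_one_eq_sum_range {M : Type*} [AddCommMonoid M] (f : ℕ → M) (n : ℕ) :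
    ∑ i ∈ Finset.Icc 1 n, f i = ∑ i ∈ Finset.range n, f (i + 1) := by
  induction n with
  | zero => simp
  | succ n ih => rw [Finset.sum_Icc_succ_top (by omega), ih, Finset.sum_range_succ]

theorem gaussianPDFReal_div_eq_exp (a b y : ℝ) :
    gaussianPDFReal a 1 y / gaussianPDFReal b 1 y
      = Real.exp ((a - b) * y - (a ^ 2 - b ^ 2) / 2) := by
  rw [← log_gaussianPDFReal_div, Real.exp_log]
  exact div_pos (gaussianPDFReal_pos _ _ _ one_ne_zero) (gaussianPDFReal_pos _ _ _ one_ne_zero)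

/-- Turns the expected stopping time into `∑ P(τ > i)`. -/
theorem toENNReal_eq_tsum (t : ℕ∞) :
    (t : ℝ≥0∞) = ∑' i : ℕ, if (i : ℕ∞) < t then (1 : ℝ≥0∞) else 0 := by
  induction t using ENat.recTopCoe with
  | top => simp
  | coe n =>
    rw [tsum_eq_sum (s := Finset.range n)]
    · simp [Finset.filter_true_of_mem]
    · intro i hi
      simpa using hi

section Observations

variable {Ω : Type*} [mΩ : MeasurableSpace Ω] {P : Measure Ω} [IsProbabilityMeasure P]
  {p : ℕ} {X : Fin p → ℕ → Ω → ℝ}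

/-- The information in the observations at times `1, …, n`. -/
def obsFiltration (X : Fin p → ℕ → Ω → ℝ) (hmeas : ∀ k ℓ, 1 ≤ ℓ → Measurable (X k ℓ)) :
    Filtration ℕ mΩ where
  seq n := ⨆ q ∈ {q : Fin p × ℕ | q.2 < n}, MeasurableSpace.comap (X q.1 (q.2 + 1)) inferInstance
  mono' _ _ h := biSup_mono fun _ hq => lt_of_lt_of_le hq h
  le' _ := iSup₂_le fun q _ => (hmeas q.1 (q.2 + 1) (by omega)).comap_le

/-- The centred observations, indexed from `0`. -/
def centred (X : Fin p → ℕ → Ω → ℝ) (μ : Fin p → ℝ) (k : Fin p) (i : ℕ) (s : Ω) : ℝ :=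
  X k (i + 1) s - μ k

theorem isGaussianNoise_centred {μ : Fin p → ℝ}
    (hmeas : ∀ k ℓ, 1 ≤ ℓ → Measurable (X k ℓ))
    (hindep : iIndepFun (fun q : Fin p × ℕ => X q.1 (q.2 + 1)) P)
    (hlaw : ∀ k ℓ, 1 ≤ ℓ → P.map (X k ℓ) = gaussianReal (μ k) 1) (k : Fin p) :
    IsGaussianNoise P (obsFiltration X hmeas) (centred X μ k) where
  adapted i := by
    have h : MeasurableSpace.comap (X k (i + 1)) inferInstance ≤ obsFiltration X hmeas (i + 1) :=
      le_iSup₂_of_le (f := fun (q : Fin p × ℕ) (_ : q ∈ {q : Fin p × ℕ | q.2 < i + 1}) =>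
        MeasurableSpace.comap (X q.1 (q.2 + 1)) inferInstance) (k, i) (Nat.lt_succ_self i) le_rfl
    exact ((comap_measurable (X k (i + 1))).mono h le_rfl).sub_const _
  indep i := by
    -- The filtration at time `i` uses pairs with second index below `i`, a set of indices disjoint
    -- from `{(k, i)}`.
    have h := indep_iSup_of_disjoint (fun q => (hmeas q.1 (q.2 + 1) (by omega)).comap_le)
      hindep.iIndep (S := {q : Fin p × ℕ | q.2 < i}) (T := {(k, i)}) (by simp)
    refine indep_of_indep_of_le_right h ?_
    refine le_iSup₂_of_le (f := fun (q : Fin p × ℕ) (_ : q ∈ ({(k, i)} : Set (Fin p × ℕ))) =>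
        MeasurableSpace.comap (X q.1 (q.2 + 1)) inferInstance) (k, i) rfl ?_
    exact ((comap_measurable (X k (i + 1))).sub_const (μ k)).comap_le
  law i := by
    have h : centred X μ k i = (fun x => x - μ k) ∘ X k (i + 1) := rfl
    rw [h, ← Measure.map_map (by fun_prop) (hmeas k (i + 1) (by omega)), hlaw k (i + 1) (by omega),
      gaussianReal_map_sub_const, sub_self]

theorem shrinkEst_succ (c : ℝ) (w μ : Fin p → ℝ) (k : Fin p) (i : ℕ) (s : Ω) :
    shrinkEst c (w k) (fun ℓ => X k ℓ s) (i + 1)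
      = plugInCoeff (shrunkMean c w μ k) c (centred X μ k) i s := by
  rcases Nat.eq_zero_or_pos i with rfl | hi
  · simp [shrinkEst, plugInCoeff]
  have hi' : (i : ℝ) ≠ 0 := by positivity
  have h1 : ¬ i + 1 ≤ 1 := by omega
  have h2 : i ≠ 0 := by omega
  simp only [shrinkEst, h1, plugInCoeff, h2, if_false, shrunkMean, runningAvg, centred,
    Nat.add_sub_cancel, sum_Icc_one_eq_sum_range, Finset.sum_sub_distrib, Finset.sum_const,
    Finset.card_range, nsmul_eq_mul]
  push_cast
  rw [add_sub_cancel_right]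
  field_simp
  ring

/-- With estimate `μ* + c ξ̄`, the log ratio is `(μ* + c ξ̄)(ξ + μ) - (μ* + c ξ̄)²/2`. The part
linear in `ξ̄` alone is `c (μ - μ*) ξ̄ = c (1 - c)(μ - ω) ξ̄`, which explains the coefficient `a`
with its sign. At `i = 0` the estimate is `0` and the factor is `1`, so the drift is missing there.
-/
theorem plugInLR_eq_exp (c : ℝ) (w μ : Fin p → ℝ) (s : Ω) (n : ℕ) :
    plugInLR c w (fun k ℓ => X k ℓ s) n = Real.exp (∑ i ∈ Finset.range n,
      llrIncr (infoNumber (shrunkMean c w μ) 0 μ) (shrunkMean c w μ)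
        (fun k => c * (1 - c) * (w k - μ k)) c (centred X μ) i s) := by
  simp only [plugInLR, gaussianPDFReal_div_eq_exp, ← Real.exp_sum, sum_Icc_one_eq_sum_range]
  congr 1
  refine Finset.sum_congr rfl fun i _ => ?_
  simp only [shrinkEst_succ c w μ]
  rcases Nat.eq_zero_or_pos i with rfl | hi
  · simp [plugInCoeff, llrIncr, martIncr, driftLoss, runningAvg_zero]
  have h2 : i ≠ 0 := by omega
  simp only [llrIncr, h2, if_false, infoNumber_shrunkMean_zero, martIncr, driftLoss, plugInCoeff]
  rw [Finset.mul_sum, ← Finset.sum_sub_distrib, Finset.mul_sum, ← Finset.sum_add_distrib,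
    ← Finset.sum_sub_distrib]
  refine Finset.sum_congr rfl fun k _ => ?_
  have hX : X k (i + 1) s = centred X μ k i s + μ k := by simp [centred]
  rw [hX]
  generalize runningAvg (centred X μ k) i s = y
  simp only [shrunkMean]
  ring

theorem lt_stopTime_iff (c : ℝ) (w μ : Fin p → ℝ) {b : ℝ} (hb : 0 < b) (i : ℕ) (s : Ω) :
    (i : ℕ∞) < stopTime c w b (fun k ℓ => X k ℓ s) ↔
      s ∈ belowUntil (llrIncr (infoNumber (shrunkMean c w μ) 0 μ) (shrunkMean c w μ)
        (fun k => c * (1 - c) * (w k - μ k)) c (centred X μ)) b i := by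
  rw [← ENat.add_one_le_iff (ENat.natCast_ne_top i), stopTime, le_iInf₂_iff]
  simp only [plugInLR_eq_exp c w μ, Real.exp_le_exp, belowUntil, Set.mem_ofPred_eq]
  constructor
  · intro h n hn
    by_contra! hcon
    -- `stopTime` ranges over `n ≥ 1` only; at `n = 0` the empty sum lies below `b` because `b > 0`.
    rcases Nat.eq_zero_or_pos n with rfl | hpos
    · simp at hcon; linarith
    · have := h n ⟨hpos, hcon⟩
      have h' : i + 1 ≤ n := by exact_mod_cast this
      omega
  · rintro h n ⟨-, hn⟩
    by_contra hcon
    have h' : ¬ i + 1 ≤ n := fun h'' => hcon (by exact_mod_cast h'')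
    exact absurd (h n (by omega)) (not_lt.2 hn)

end Observations

/-! ### Asymptotics and conclusion -/

theorem abs_sum_inv_sub_log_le {x : ℝ} (hx : 1 < x) :
    |∑ i ∈ Finset.range ⌈x⌉₊, 1 / (i : ℝ) - Real.log x| ≤ 1 := by
  have hx0 : 0 < x := by linarith
  obtain ⟨n, hn⟩ : ∃ n, ⌈x⌉₊ = n + 1 :=
    Nat.exists_eq_succ_of_ne_zero (Nat.ceil_pos.2 hx0).ne'
  have h1 : ∑ i ∈ Finset.range ⌈x⌉₊, 1 / (i : ℝ) = harm n := by
    rw [hn, Finset.sum_range_succ']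
    simp [harm]
  have h2 : x ≤ n + 1 := by have := Nat.le_ceil x; rw [hn] at this; exact_mod_cast this
  have h3 : (n : ℝ) < x := by
    have := Nat.ceil_lt_add_one hx0.le
    rw [hn] at this; push_cast at this; linarith
  have hn0 : (0 : ℝ) < n := by
    rcases Nat.eq_zero_or_pos n with rfl | h
    · norm_num at h2; linarith
    · exact_mod_cast h
  rw [h1, abs_le]
  have h4 := harm_le_one_add_log n
  have h5 := Real.log_le_log hn0 h3.le
  have h6 := log_le_harm (n + 1)
  have h7 : harm (n + 1) = harm n + 1 / ((n : ℝ) + 1) := by simp [harm, Finset.sum_range_succ]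
  have h8 : Real.log x ≤ Real.log ((n + 1 : ℕ) : ℝ) := Real.log_le_log hx0 (by exact_mod_cast h2)
  have h9 : 1 / ((n : ℝ) + 1) ≤ 1 := by
    rw [div_le_one (by positivity)]; linarith
  constructor <;> linarith

/-- The harmonic sum is `log b - log I + O(1)`. With `η = ε q I / 2`, every bounded error is
eventually at most `η log b`, and `2 η log b = ε (q log b) I`. -/
theorem isLittleO_of_passage_bound {E : ℝ → ℝ} {I A q : ℝ} (hI : 0 < I) (hA : 0 ≤ A) (hq : 0 < q)
    (h : ∀ η > 0, ∃ K, ∀ b : ℝ, 0 < b →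
      |I * E b - b - A * ∑ i ∈ Finset.range ⌈b / I⌉₊, 1 / (i : ℝ)|
        ≤ η * Real.log ((2 * ⌈b / I⌉₊ : ℕ) : ℝ) + K) :
    (fun b => E b - (b + A * Real.log b - A * Real.log I) / I)
      =o[atTop] fun b : ℝ => q * Real.log b := by
  rw [isLittleO_iff]
  intro ε hε
  obtain ⟨K, hK⟩ := h (ε * q * I / 2) (by positivity)
  set η := ε * q * I / 2 with hη
  have hη0 : 0 < η := by positivity
  have hlog := Real.tendsto_log_atTop.eventually_ge_atTop
    ((A + η * Real.log (4 / I) + K) / η)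
  filter_upwards [hlog, eventually_gt_atTop I, eventually_ge_atTop 1] with b h1 h2 h3
  have hb : 0 < b := by linarith
  have hbI : 1 < b / I := by rwa [lt_div_iff₀ hI, one_mul]
  have hlogb : 0 ≤ Real.log b := Real.log_nonneg h3
  have h4 := hK b hb
  have h5 := abs_sum_inv_sub_log_le hbI
  rw [Real.log_div hb.ne' hI.ne'] at h5
  have h6 : Real.log ((2 * ⌈b / I⌉₊ : ℕ) : ℝ) ≤ Real.log b + Real.log (4 / I) := by
    rw [← Real.log_mul hb.ne' (by positivity)]
    have hc : 0 < ⌈b / I⌉₊ := Nat.ceil_pos.2 (by positivity)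
    have h7 := Nat.ceil_lt_add_one (show 0 ≤ b / I by positivity)
    refine Real.log_le_log (by exact_mod_cast (by omega : 0 < 2 * ⌈b / I⌉₊)) ?_
    push_cast
    have : b * (4 / I) = 4 * (b / I) := by ring
    linarith
  set S := ∑ i ∈ Finset.range ⌈b / I⌉₊, 1 / (i : ℝ)
  have h8 : |I * E b - b - A * (Real.log b - Real.log I)|
      ≤ A + (η * (Real.log b + Real.log (4 / I)) + K) := by
    have e : I * E b - b - A * (Real.log b - Real.log I)
        = A * (S - (Real.log b - Real.log I)) + (I * E b - b - A * S) := by ring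
    rw [e]
    refine (abs_add_le _ _).trans (add_le_add ?_ (h4.trans ?_))
    · rw [abs_mul, abs_of_nonneg hA]
      nlinarith
    · have := mul_le_mul_of_nonneg_left h6 hη0.le
      linarith
  rw [div_le_iff₀ hη0] at h1
  have e : E b - (b + A * Real.log b - A * Real.log I) / I
      = (I * E b - b - A * (Real.log b - Real.log I)) / I := by field_simp; ring
  rw [e, Real.norm_eq_abs, Real.norm_eq_abs, abs_div, abs_of_pos hI, div_le_iff₀ hI,
    abs_of_nonneg (mul_nonneg hq.le hlogb)]
  have h9 : ε * (q * Real.log b) * I = 2 * η * Real.log b := by rw [hη]; ring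
  rw [h9]
  linarith

theorem theorem1
    {Ω : Type*} [MeasurableSpace Ω] (P : Measure Ω) [IsProbabilityMeasure P]
    (p : ℕ) (c : ℝ) (hc : c ∈ Set.Icc (0 : ℝ) 1)
    (w : Fin p → ℝ) (hw : ∀ k, 0 ≤ w k) (hw' : ∃ k, 0 < w k)
    (μ : Fin p → ℝ)
    -- `X k ℓ` is the observation of stream `k` at time `ℓ = 1, 2, …`
    (X : Fin p → ℕ → Ω → ℝ)
    (hmeas : ∀ k ℓ, 1 ≤ ℓ → Measurable (X k ℓ))
    (hindep : iIndepFun (fun q : Fin p × ℕ => X q.1 (q.2 + 1)) P)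
    (hlaw : ∀ k ℓ, 1 ≤ ℓ → P.map (X k ℓ) = gaussianReal (μ k) 1)
    (hI : 0 < infoNumber (shrunkMean c w μ) 0 μ) :
    (∀ b : ℝ, ∫⁻ s, (stopTime c w b (fun k ℓ => X k ℓ s) : ℝ≥0∞) ∂P ≠ ∞) ∧
    (fun b : ℝ =>
        (∫⁻ s, (stopTime c w b (fun k ℓ => X k ℓ s) : ℝ≥0∞) ∂P).toReal
          - (b + (p * c ^ 2 / 2) * Real.log b
              - (p * c ^ 2 / 2) * Real.log (infoNumber (shrunkMean c w μ) 0 μ))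
            / infoNumber (shrunkMean c w μ) 0 μ)
      =o[atTop] (fun b : ℝ => (p : ℝ) * Real.log b) := by
  have hnoise := isGaussianNoise_centred hmeas hindep hlaw
  set a : Fin p → ℝ := fun k => c * (1 - c) * (w k - μ k) with ha
  obtain ⟨C, hwalk⟩ := exists_isPerturbedWalk hnoise hI (shrunkMean c w μ) a c
  set I := infoNumber (shrunkMean c w μ) 0 μ with hIdef
  set Z := llrIncr I (shrunkMean c w μ) a c (centred X μ) with hZ
  have hA := fun b i => (obsFiltration X hmeas).le _ _ (hwalk.measurableSet_belowUntil b i)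
  have hE : ∀ b : ℝ, 0 < b → ∫⁻ s, (stopTime c w b (fun k ℓ => X k ℓ s) : ℝ≥0∞) ∂P
      = ENNReal.ofReal (∑' i, P.real (belowUntil Z b i)) := fun b hb => by
    have h1 : ∀ s, (stopTime c w b (fun k ℓ => X k ℓ s) : ℝ≥0∞)
        = ∑' i : ℕ, (belowUntil Z b i).indicator 1 s := fun s => by
      rw [toENNReal_eq_tsum]
      refine tsum_congr fun i => ?_
      classical
      simp only [lt_stopTime_iff c w μ hb, Set.indicator_apply, Pi.one_apply]
      rfl
    simp only [h1]
    rw [lintegral_tsum fun i => (measurable_one.indicator (hA b i)).aemeasurable,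
      ENNReal.ofReal_tsum_of_nonneg (fun _ => measureReal_nonneg) (hwalk.summable_belowUntil b)]
    refine tsum_congr fun i => ?_
    rw [lintegral_indicator_one (hA b i), ofReal_measureReal]
  refine ⟨fun b => ?_, ?_⟩
  -- The stopping time is monotone in `b`, so finiteness for `b ≤ 0` follows from a positive level.
  · have hle : ∫⁻ s, (stopTime c w b (fun k ℓ => X k ℓ s) : ℝ≥0∞) ∂P
        ≤ ∫⁻ s, (stopTime c w (max b 1) (fun k ℓ => X k ℓ s) : ℝ≥0∞) ∂P := by
      refine lintegral_mono fun s => ENat.toENNReal_le.2 (le_iInf₂ fun n hn => iInf₂_le n ⟨hn.1, ?_⟩)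
      exact (Real.exp_le_exp.2 (le_max_left b 1)).trans hn.2
    refine ne_top_of_le_ne_top ?_ hle
    rw [hE _ (lt_max_of_lt_right one_pos)]
    exact ENNReal.ofReal_ne_top
  · have hp : (0 : ℝ) < p := by
      obtain ⟨k, -⟩ := hw'
      exact_mod_cast k.pos
    refine (isLittleO_of_passage_bound (E := fun b => ∑' i, P.real (belowUntil Z b i)) hI
      (A := p * c ^ 2 / 2) (by positivity) hp fun η hη => ?_).congr' ?_ EventuallyEq.rfl
    · obtain ⟨K, hK⟩ := hwalk.expected_passage hη
      refine ⟨K, fun b hb => ?_⟩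
      have h := hK b hb
      simp only [integral_driftLoss hnoise, ← Finset.mul_sum] at h
      exact h
    · filter_upwards [eventually_gt_atTop 0] with b hb
      rw [hE b hb, ENNReal.toReal_ofReal (tsum_nonneg fun _ => measureReal_nonneg)]
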